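/- Let $P2/m$ denote the space group (No. 10 in the International Tables for Crystallography) with the presentation $$P2/m=\left\langle x,y,z,r,m \;\middle|\; \begin{array}{l}[x,y],\ [x,z],\ [y,z],\ r^2,\ m^2,\ (mr)^2,\\ x^m=x,\ y^m=y^{-1},\ z^m=z,\ x^r=x^{-1},\ y^r=y,\ z^r=z^{-1}\end{array}\right\rangle,$$ where $a^b=b^{-1}ab$. For a positive integer $n$, let $a_n$ be the number of subgroups of index $n$ in $P2/m$, let $d(n)$ be the number of positive divisors of $n$, and let $\sigma(n)=\sum_{l\mid n} l$ be the sum of its positive divisors. All sums below run over positive divisors $l$. Then, for every positive integer $n$: 1. If $n\equiv 2$ or $n\equiv 6 \pmod 8$, then $$a_n = n\sum_{l\mid n}\sigma(l)+10n\sum_{l\mid \frac n2}\sigma(l)+\sum_{l\mid \frac n2} l\,d(l)+\left(\frac n2+1\right)\sum_{l\mid \frac n2} l\,\sigma(l).$$ 2. If $n\equiv 4 \pmod 8$, then $$a_n = n\sum_{l\mid n}\sigma(l)+10n\sum_{l\mid \frac n2}\sigma(l)+9n\sum_{l\mid \frac n4}\sigma(l)+\sum_{l\mid \frac n2} l\,d(l)+9\sum_{l\mid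 \frac n4} l\,d(l)+8\sum_{l\mid \frac n4} l\,\sigma(l)+\left(\frac n2+1\right)\sum_{l\mid \frac n2} l\,\sigma(l).$$ 3. If $n\equiv 0 \pmod 8$, then $$a_n = n\sum_{l\mid n}\sigma(l)+10n\sum_{l\mid \frac n2}\sigma(l)+9n\sum_{l\mid \frac n4}\sigma(l)+\sum_{l\mid \frac n2} l\,d(l)+9\sum_{l\mid \frac n4} l\,d(l)+8\sum_{l\mid \frac n4} l\,\sigma(l)+\left(\frac n2+1\right)\sum_{l\mid \frac n2} l\,\sigma(l)+6\sum_{l\mid \frac n8} l\,d(l).$$ 4. If $n$ is odd, then $$a_n = n\sum_{l\mid n}\sigma(l).$$ In particular, $a_p=p^2+2p$ for every odd prime $p$. -/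

import Mathlib

open scoped ArithmeticFunction.sigma commutatorElement

namespace P2m

/-- The five generators: translations `x`, `y`, `z`, diad rotation `r`, reflection `m`. -/
inductive Gen
  | x | y | z | r | m

/-- The free generator attached to an element of `Gen`. -/
abbrev g (a : Gen) : FreeGroup Gen := FreeGroup.of a

/-- The conjugate `a ^ b = b⁻¹ a b`. -/
def conjBy {H : Type*} [Group H] (a b : H) : H := b⁻¹ * a * b

/-- The defining relators of the space group `P2/m`; a relation `u = v` is entered as the
relator `u * v⁻¹`. -/
def rels : Set (FreeGroup Gen) :=
  { ⁅g .x, g .y⁆, ⁅g .x, g .z⁆, ⁅g .y, g .z⁆,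
    g .r ^ 2, g .m ^ 2, (g .m * g .r) ^ 2,
    conjBy (g .x) (g .m) * (g .x)⁻¹,
    conjBy (g .y) (g .m) * ((g .y)⁻¹)⁻¹,
    conjBy (g .z) (g .m) * (g .z)⁻¹,
    conjBy (g .x) (g .r) * ((g .x)⁻¹)⁻¹,
    conjBy (g .y) (g .r) * (g .y)⁻¹,
    conjBy (g .z) (g .r) * ((g .z)⁻¹)⁻¹ }

/-- The space group `P2/m`, given by generators and relations. -/
abbrev Grp : Type := PresentedGroup rels

end P2m

/-- The number `a_n(G)` of subgroups of index `n` in `G`, for `n ≥ 1`. (For `n = 0`, Mathlib's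
`Subgroup.index` encodes infinite index.) -/
noncomputable def numSubgroupsOfIndex (G : Type*) [Group G] (n : ℕ) : ℕ :=
  {H : Subgroup G | H.index = n}.ncard

/-! The generators `y`, `m` commute with `x`, `z`, `r`, so the group splits as D∞ × p2, where both
factors are generalised dihedral: D∞ over ℤ and p2 over ℤ² (`P2m.equivProd`). By Goursat's argument
a subgroup of D × E is a subgroup A of E (its projection), a subgroup K of D (its intersection with
D) and a homomorphism A → N(K)/K, and its index is [E : A][D : K] (`goursatEquiv`). Hence a_n is a
sum of numbers of homomorphisms over factorisations n = kj.

All ingredients are explicit. A subgroup of a generalised dihedral group is either a lattice L of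
rotations, or L together with one coset of reflections (`GenDihedral.subgroupEquiv`). So A is
isomorphic to ℤ², in σ(k/2) ways for k even, or to p2, in kσ(k) ways. For K in D∞, the quotient
N(K)/K is dihedral over ℤ/(j/2) if K consists of rotations; otherwise it has order gcd(j, 2). For a
finite abelian group B with t solutions of b² = 1, there are |B|² + 3|B|t homomorphisms from ℤ² to
the generalised dihedral group of B (`GenDihedral.card_hom_freeAbTwo`), and |B|³ + 6|B|t² + t³ from
p2 (`GenDihedral.card_hom_genDihedral_freeAbTwo`).

This gives the divisor sum `GenDihedral.numSubgroupsOfIndex_prod_eq`. Its parity conditions turn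
into sums over the divisors of n/2, n/4 and n/8, and Dirichlet convolution identities such as
`sum_sigma_mul_pow` evaluate them. -/

theorem Subgroup.relIndex_sup_of_normal {G : Type*} [Group G] (H N : Subgroup G) [N.Normal] :
    H.relIndex (N ⊔ H) = H.relIndex N := by
  refine (Nat.card_eq_of_bijective (Subgroup.quotientSubgroupOfEmbeddingOfLE H
    (le_sup_left : N ≤ N ⊔ H)) ⟨(Subgroup.quotientSubgroupOfEmbeddingOfLE H _).injective, ?_⟩).symm
  intro q
  induction q using QuotientGroup.induction_on with
  | H x =>
    obtain ⟨x, hx⟩ := x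
    -- `N ⊔ H` is the set product NH because N is normal, so every left coset of H in it has a
    -- representative in N; H itself need not be normal.
    obtain ⟨n, hn, h, hh, rfl⟩ : ∃ n ∈ N, ∃ h ∈ H, n * h = x := by
      rw [← SetLike.mem_coe, Subgroup.normal_mul] at hx
      exact Set.mem_mul.1 hx
    refine ⟨QuotientGroup.mk ⟨n, hn⟩, ?_⟩
    rw [Subgroup.quotientSubgroupOfEmbeddingOfLE_apply_mk]
    rw [QuotientGroup.eq, Subgroup.mem_subgroupOf]
    simpa using hh

/-! ### Goursat's description of subgroups of a direct product. -/

section Goursat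

variable {D E : Type*} [Group D] [Group E]

/-- With N = ker(snd) = D × 1, the index factors through `H ⊔ N`: the upper step is the index of the
projection, the lower one that of H ∩ N in N. -/
theorem Subgroup.index_eq_comap_inl_mul_map_snd (H : Subgroup (D × E)) :
    H.index = (H.comap (MonoidHom.inl D E)).index * (H.map (MonoidHom.snd D E)).index := by
  have hr : (MonoidHom.inl D E).range = (MonoidHom.snd D E).ker := by
    ext ⟨a, b⟩
    rw [MonoidHom.mem_ker, MonoidHom.mem_range]
    simp [Prod.ext_iff, eq_comm]
  have hs : Function.Surjective (MonoidHom.snd D E) := Prod.snd_surjective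
  rw [Subgroup.index_comap, Subgroup.index_map, MonoidHom.range_eq_top.2 hs, Subgroup.index_top,
    mul_one, hr, ← Subgroup.relIndex_sup_of_normal H, sup_comm H,
    Subgroup.relIndex_mul_index le_sup_right]

/-- The quotient `N(K)/K` of the normalizer of a subgroup. -/
abbrev NormalizerQuotient (K : Subgroup D) : Type _ :=
  Subgroup.normalizer (K : Set D) ⧸ K.subgroupOf (Subgroup.normalizer (K : Set D))

/-- The subgroup of `D × E` attached to a homomorphism `A →* N(K)/K`. -/
def goursatSubgroup (A : Subgroup E) (K : Subgroup D) (φ : A →* NormalizerQuotient K) :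
    Subgroup (D × E) where
  carrier := {p | ∃ (hd : p.1 ∈ Subgroup.normalizer (K : Set D)) (ha : p.2 ∈ A),
    φ ⟨p.2, ha⟩ = QuotientGroup.mk ⟨p.1, hd⟩}
  one_mem' := ⟨one_mem _, one_mem _, map_one φ⟩
  mul_mem' := by
    rintro p q ⟨hp, ha, h⟩ ⟨hq, hb, h'⟩
    refine ⟨mul_mem hp hq, mul_mem ha hb, ?_⟩
    exact (map_mul φ ⟨p.2, ha⟩ ⟨q.2, hb⟩).trans (by rw [h, h', ← QuotientGroup.mk_mul])
  inv_mem' := by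
    rintro p ⟨hp, ha, h⟩
    refine ⟨inv_mem hp, inv_mem ha, ?_⟩
    exact (map_inv φ ⟨p.2, ha⟩).trans (by rw [h, ← QuotientGroup.mk_inv])

theorem mem_goursatSubgroup {A : Subgroup E} {K : Subgroup D} {φ : A →* NormalizerQuotient K}
    {p : D × E} : p ∈ goursatSubgroup A K φ ↔
      ∃ (hd : p.1 ∈ Subgroup.normalizer (K : Set D)) (ha : p.2 ∈ A),
        φ ⟨p.2, ha⟩ = QuotientGroup.mk ⟨p.1, hd⟩ := Iff.rfl

theorem comap_inl_goursatSubgroup (A : Subgroup E) (K : Subgroup D)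
    (φ : A →* NormalizerQuotient K) :
    (goursatSubgroup A K φ).comap (MonoidHom.inl D E) = K := by
  ext d
  rw [Subgroup.mem_comap, mem_goursatSubgroup]
  have h1 : φ ⟨1, one_mem A⟩ = 1 := map_one φ
  constructor
  · rintro ⟨hd, ha, h⟩
    have := h1.symm.trans h
    rw [eq_comm, QuotientGroup.eq_one_iff, Subgroup.mem_subgroupOf] at this
    exact this
  · intro hd
    refine ⟨Subgroup.le_normalizer hd, one_mem A, ?_⟩
    refine h1.trans ?_
    rw [eq_comm, QuotientGroup.eq_one_iff, Subgroup.mem_subgroupOf]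
    exact hd

theorem map_snd_goursatSubgroup (A : Subgroup E) (K : Subgroup D)
    (φ : A →* NormalizerQuotient K) :
    (goursatSubgroup A K φ).map (MonoidHom.snd D E) = A := by
  ext a
  rw [Subgroup.mem_map]
  constructor
  · rintro ⟨p, ⟨-, ha, -⟩, rfl⟩
    exact ha
  · intro ha
    obtain ⟨⟨d, hd⟩, h⟩ := QuotientGroup.mk_surjective (φ ⟨a, ha⟩)
    exact ⟨(d, a), ⟨hd, ha, h.symm⟩, rfl⟩

theorem goursatSubgroup_injective (A : Subgroup E) (K : Subgroup D) :
    Function.Injective (goursatSubgroup A K) := by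
  intro φ ψ h
  ext ⟨a, ha⟩
  obtain ⟨⟨d, hd⟩, h'⟩ := QuotientGroup.mk_surjective (φ ⟨a, ha⟩)
  have : (d, a) ∈ goursatSubgroup A K φ := ⟨hd, ha, h'.symm⟩
  rw [h] at this
  obtain ⟨_, _, h''⟩ := this
  rw [← h', h'']

/-- Send a to the class of any d with (d, a) ∈ H. Conjugation by (d, a) preserves H and D × 1, so d
normalizes K; two choices of d differ by an element of K, so the class is well defined and
multiplicative. -/
theorem exists_goursatSubgroup_eq (H : Subgroup (D × E)) :
    ∃ φ, goursatSubgroup (H.map (MonoidHom.snd D E)) (H.comap (MonoidHom.inl D E)) φ = H := by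
  have hex : ∀ a : H.map (MonoidHom.snd D E), ∃ d, (d, (a : E)) ∈ H := by
    rintro ⟨_, ⟨d, a⟩, h, rfl⟩
    exact ⟨d, h⟩
  choose f hf using hex
  have hN : ∀ d a, (d, a) ∈ H →
      d ∈ Subgroup.normalizer ((H.comap (MonoidHom.inl D E) : Subgroup D) : Set D) := by
    intro d a h
    rw [Subgroup.mem_normalizer_iff]
    intro k
    have : ((d * k * d⁻¹, 1) : D × E) = (d, a) * (k, 1) * (d, a)⁻¹ := by simp
    simp only [Subgroup.mem_comap, MonoidHom.inl_apply]
    rw [this, Subgroup.mul_mem_cancel_right _ (inv_mem h), Subgroup.mul_mem_cancel_left _ h]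
  have hq : ∀ d e a (h : (d, a) ∈ H) (h' : (e, a) ∈ H),
      (QuotientGroup.mk ⟨d, hN d a h⟩ : NormalizerQuotient (H.comap (MonoidHom.inl D E))) =
        QuotientGroup.mk ⟨e, hN e a h'⟩ := by
    intro d e a h h'
    rw [QuotientGroup.eq, Subgroup.mem_subgroupOf, Subgroup.mem_comap]
    change (d⁻¹ * e, (1 : E)) ∈ H
    simpa using mul_mem (inv_mem h) h'
  refine ⟨MonoidHom.mk' (fun a => QuotientGroup.mk ⟨f a, hN _ _ (hf a)⟩) ?_, ?_⟩
  · intro a b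
    exact hq _ _ _ (hf (a * b)) (mul_mem (hf a) (hf b))
  · ext ⟨d, a⟩
    constructor
    · rintro ⟨hd, ha, h⟩
      have h2 : (f ⟨a, ha⟩, a) ∈ H := hf ⟨a, ha⟩
      replace h : (QuotientGroup.mk ⟨f ⟨a, ha⟩, hN _ _ h2⟩ :
        NormalizerQuotient (H.comap (MonoidHom.inl D E))) = QuotientGroup.mk ⟨d, hd⟩ := h
      rw [QuotientGroup.eq, Subgroup.mem_subgroupOf, Subgroup.mem_comap] at h
      replace h : ((f ⟨a, ha⟩)⁻¹ * d, (1 : E)) ∈ H := h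
      simpa using mul_mem h2 h
    · intro h
      exact ⟨hN _ _ h, ⟨_, h, rfl⟩, hq _ _ _ (hf ⟨a, ⟨_, h, rfl⟩⟩) h⟩

/-- Goursat: subgroups of `D × E` of index `n` are triples `(A, K, A →* N(K)/K)`. -/
noncomputable def goursatEquiv {n : ℕ} (hn : 0 < n) :
    (Σ p : n.divisorsAntidiagonal, Σ A : {A : Subgroup E // A.index = p.1.1},
      Σ K : {K : Subgroup D // K.index = p.1.2}, (A.1 →* NormalizerQuotient K.1)) ≃
    {H : Subgroup (D × E) // H.index = n} :=
  Equiv.ofBijective (fun t => ⟨goursatSubgroup t.2.1.1 t.2.2.1.1 t.2.2.2, by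
      rw [Subgroup.index_eq_comap_inl_mul_map_snd, comap_inl_goursatSubgroup,
        map_snd_goursatSubgroup, t.2.1.2, t.2.2.1.2, mul_comm]
      exact (Nat.mem_divisorsAntidiagonal.1 t.1.2).1⟩) <| by
    constructor
    · rintro ⟨⟨⟨k, j⟩, hp⟩, ⟨A, hA⟩, ⟨K, hK⟩, φ⟩ ⟨⟨⟨k', j'⟩, hp'⟩, ⟨A', hA'⟩, ⟨K', hK'⟩, ψ⟩ h
      have h : goursatSubgroup A K φ = goursatSubgroup A' K' ψ := congrArg Subtype.val h
      obtain rfl : A = A' := by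
        rw [← map_snd_goursatSubgroup A K φ, h, map_snd_goursatSubgroup]
      obtain rfl : K = K' := by
        rw [← comap_inl_goursatSubgroup A K φ, h, comap_inl_goursatSubgroup]
      obtain rfl : k = k' := hA.symm.trans hA'
      obtain rfl : j = j' := hK.symm.trans hK'
      rw [goursatSubgroup_injective _ _ h]
    · rintro ⟨H, hH⟩
      obtain ⟨φ, hφ⟩ := exists_goursatSubgroup_eq H
      refine ⟨⟨⟨((H.map (MonoidHom.snd D E)).index, (H.comap (MonoidHom.inl D E)).index), ?_⟩,
        ⟨_, rfl⟩, ⟨_, rfl⟩, φ⟩, Subtype.ext hφ⟩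
      rw [Nat.mem_divisorsAntidiagonal, mul_comm, ← Subgroup.index_eq_comap_inl_mul_map_snd]
      exact ⟨hH, hn.ne'⟩

theorem finite_normalizerQuotient {K : Subgroup D} (h : K.index ≠ 0) :
    Finite (NormalizerQuotient K) := by
  have : K.FiniteIndex := ⟨h⟩
  infer_instance

/-- Finitely many homomorphisms into each finite group. -/
def HomFinite (A : Type*) [Group A] : Prop :=
  ∀ (Q : Type) [Group Q] [Finite Q], Finite (A →* Q)

theorem numSubgroupsOfIndex_eq_card (G : Type*) [Group G] (n : ℕ) :
    numSubgroupsOfIndex G n = Nat.card {H : Subgroup G // H.index = n} := rfl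

theorem finite_subgroups_prod {D : Type} [Group D]
    (hE : ∀ k, 0 < k → Finite {A : Subgroup E // A.index = k})
    (hD : ∀ k, 0 < k → Finite {A : Subgroup D // A.index = k})
    (hA : ∀ A : Subgroup E, A.index ≠ 0 → HomFinite A) {n : ℕ} (hn : 0 < n) :
    Finite {H : Subgroup (D × E) // H.index = n} := by
  have h1 : ∀ p : n.divisorsAntidiagonal, Finite {A : Subgroup E // A.index = p.1.1} := fun p =>
    hE _ (Nat.pos_of_ne_zero (Nat.ne_zero_of_mem_divisorsAntidiagonal p.2).1)
  have h2 : ∀ p : n.divisorsAntidiagonal, Finite {A : Subgroup D // A.index = p.1.2} := fun p =>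
    hD _ (Nat.pos_of_ne_zero (Nat.ne_zero_of_mem_divisorsAntidiagonal p.2).2)
  have h3 : ∀ (p : n.divisorsAntidiagonal) (A : {A : Subgroup E // A.index = p.1.1})
      (K : {K : Subgroup D // K.index = p.1.2}), Finite (A.1 →* NormalizerQuotient K.1) := by
    intro p A K
    have := finite_normalizerQuotient (K := K.1)
      (K.2.trans_ne (Nat.ne_zero_of_mem_divisorsAntidiagonal p.2).2)
    exact hA A.1 (A.2.trans_ne (Nat.ne_zero_of_mem_divisorsAntidiagonal p.2).1) _
  exact Finite.of_equiv _ (goursatEquiv hn)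

/-- Counts the Goursat triples. Finiteness matters: `Nat.card` and `∑ᶠ` take the value 0 on infinite
data. -/
theorem numSubgroupsOfIndex_prod {D : Type} [Group D]
    (hE : ∀ k, 0 < k → Finite {A : Subgroup E // A.index = k})
    (hD : ∀ k, 0 < k → Finite {A : Subgroup D // A.index = k})
    (hA : ∀ A : Subgroup E, A.index ≠ 0 → HomFinite A) {n : ℕ} (hn : 0 < n) :
    numSubgroupsOfIndex (D × E) n = ∑ p ∈ n.divisorsAntidiagonal,
      ∑ᶠ A : {A : Subgroup E // A.index = p.1}, ∑ᶠ K : {K : Subgroup D // K.index = p.2},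
        Nat.card (A.1 →* NormalizerQuotient K.1) := by
  have h1 : ∀ p : n.divisorsAntidiagonal, Finite {A : Subgroup E // A.index = p.1.1} := fun p =>
    hE _ (Nat.pos_of_ne_zero (Nat.ne_zero_of_mem_divisorsAntidiagonal p.2).1)
  have h2 : ∀ p : n.divisorsAntidiagonal, Finite {A : Subgroup D // A.index = p.1.2} := fun p =>
    hD _ (Nat.pos_of_ne_zero (Nat.ne_zero_of_mem_divisorsAntidiagonal p.2).2)
  have h3 : ∀ (p : n.divisorsAntidiagonal) (A : {A : Subgroup E // A.index = p.1.1})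
      (K : {K : Subgroup D // K.index = p.1.2}), Finite (A.1 →* NormalizerQuotient K.1) := by
    intro p A K
    have := finite_normalizerQuotient (K := K.1)
      (K.2.trans_ne (Nat.ne_zero_of_mem_divisorsAntidiagonal p.2).2)
    exact hA A.1 (A.2.trans_ne (Nat.ne_zero_of_mem_divisorsAntidiagonal p.2).1) _
  rw [numSubgroupsOfIndex_eq_card, ← Nat.card_congr (goursatEquiv hn), Nat.card_sigma,
    ← Finset.sum_coe_sort n.divisorsAntidiagonal]
  refine Finset.sum_congr rfl fun p _ => ?_
  have := Fintype.ofFinite {A : Subgroup E // A.index = p.1.1}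
  have := Fintype.ofFinite {A : Subgroup D // A.index = p.1.2}
  rw [Nat.card_sigma, finsum_eq_sum_of_fintype]
  refine Finset.sum_congr rfl fun A _ => ?_
  rw [Nat.card_sigma, finsum_eq_sum_of_fintype]

end Goursat

/-! ### Generalised dihedral groups: subgroups, normalizers and their quotients. -/

/-- The generalised dihedral group `A ⋊ {±1}` of a commutative group `A`. -/
@[ext] structure GenDihedral (A : Type*) where
  /-- The component in `A`. -/
  pt : A
  /-- The sign. -/
  sgn : ℤˣ

namespace GenDihedral

variable {A : Type*} [CommGroup A]

instance : Group (GenDihedral A) where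
  mul p q := ⟨p.pt * q.pt ^ (p.sgn : ℤ), p.sgn * q.sgn⟩
  one := ⟨1, 1⟩
  inv p := ⟨p.pt ^ (-(p.sgn : ℤ)), p.sgn⟩
  mul_assoc := by
    rintro ⟨a, s⟩ ⟨b, t⟩ ⟨c, u⟩
    change (⟨(a * b ^ (s : ℤ)) * c ^ ((s * t : ℤˣ) : ℤ), s * t * u⟩ : GenDihedral A) =
      ⟨a * (b * c ^ (t : ℤ)) ^ (s : ℤ), s * (t * u)⟩
    rw [mul_zpow, ← zpow_mul, mul_assoc, mul_assoc s, Units.val_mul, mul_comm (t : ℤ)]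
  one_mul := by
    rintro ⟨a, s⟩
    change (⟨1 * a ^ ((1 : ℤˣ) : ℤ), 1 * s⟩ : GenDihedral A) = ⟨a, s⟩
    simp
  mul_one := by
    rintro ⟨a, s⟩
    change (⟨a * 1 ^ (s : ℤ), s * 1⟩ : GenDihedral A) = ⟨a, s⟩
    simp
  inv_mul_cancel := by
    rintro ⟨a, s⟩
    change (⟨a ^ (-(s : ℤ)) * a ^ (s : ℤ), s * s⟩ : GenDihedral A) = ⟨1, 1⟩
    simp

@[simp] theorem mk_mul_mk (a b : A) (s t : ℤˣ) :
    (⟨a, s⟩ * ⟨b, t⟩ : GenDihedral A) = ⟨a * b ^ (s : ℤ), s * t⟩ := rfl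

@[simp] theorem mk_inv (a : A) (s : ℤˣ) :
    (⟨a, s⟩⁻¹ : GenDihedral A) = ⟨a ^ (-(s : ℤ)), s⟩ := rfl

theorem one_def : (1 : GenDihedral A) = ⟨1, 1⟩ := rfl

@[simp] theorem mk_eq_one (a : A) (s : ℤˣ) :
    (⟨a, s⟩ : GenDihedral A) = 1 ↔ a = 1 ∧ s = 1 := by
  rw [one_def, GenDihedral.mk.injEq]

/-- The underlying pair. -/
def equivProd : GenDihedral A ≃ A × ℤˣ where
  toFun p := (p.pt, p.sgn)
  invFun p := ⟨p.1, p.2⟩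
  left_inv _ := rfl
  right_inv _ := rfl

instance [Finite A] : Finite (GenDihedral A) := Finite.of_equiv _ equivProd.symm

/-- The inclusion of the rotation subgroup. -/
def inl : A →* GenDihedral A where
  toFun a := ⟨a, 1⟩
  map_one' := rfl
  map_mul' a b := by simp

@[simp] theorem inl_apply (a : A) : inl a = (⟨a, 1⟩ : GenDihedral A) := rfl

theorem inl_injective : Function.Injective (inl : A →* GenDihedral A) := fun a b h => by
  simpa using h

/-- The sign homomorphism. -/
def sign : GenDihedral A →* ℤˣ where
  toFun p := p.sgn
  map_one' := rfl
  map_mul' _ _ := rfl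

theorem sign_surjective : Function.Surjective (sign : GenDihedral A →* ℤˣ) :=
  fun s => ⟨⟨1, s⟩, rfl⟩

theorem range_inl : (inl : A →* GenDihedral A).range = (sign : GenDihedral A →* ℤˣ).ker := by
  ext ⟨a, s⟩
  rw [MonoidHom.mem_ker, MonoidHom.mem_range]
  change (∃ x, (⟨x, 1⟩ : GenDihedral A) = ⟨a, s⟩) ↔ s = 1
  simp [eq_comm]

theorem index_range_inl : (inl : A →* GenDihedral A).range.index = 2 := by
  rw [range_inl, Subgroup.index_ker, MonoidHom.range_eq_top.2 sign_surjective, Subgroup.card_top]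
  simp

/-- The basic reflection. -/
def refl : GenDihedral A := ⟨1, -1⟩

section Lift

variable {H : Type*} [Group H]

/-- The homomorphism defined by its restriction to `A` and the image of the reflection. -/
def lift (f : A →* H) (ρ : H) (h1 : ρ * ρ = 1) (h2 : ∀ a, ρ * f a * ρ = (f a)⁻¹) :
    GenDihedral A →* H where
  toFun p := f p.pt * if p.sgn = 1 then 1 else ρ
  map_one' := by simp [one_def]
  map_mul' := by
    have h3 : ∀ a, (f a)⁻¹ * ρ = ρ * f a := fun a => by rw [← h2, mul_assoc, h1, mul_one]
    rintro ⟨a, s⟩ ⟨b, t⟩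
    rcases Int.units_eq_one_or s with rfl | rfl <;> rcases Int.units_eq_one_or t with rfl | rfl
    · simp
    · simp [mul_assoc]
    · simp [mul_assoc, h3]
    · have : ρ * (f b * ρ) = (f b)⁻¹ := by rw [← mul_assoc, h2]
      simp [mul_assoc, this]

@[simp] theorem lift_inl (f : A →* H) (ρ : H) (h1 : ρ * ρ = 1)
    (h2 : ∀ a, ρ * f a * ρ = (f a)⁻¹) (a : A) : lift f ρ h1 h2 ⟨a, 1⟩ = f a := by
  simp [lift]

theorem lift_neg (f : A →* H) (ρ : H) (h1 : ρ * ρ = 1)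
    (h2 : ∀ a, ρ * f a * ρ = (f a)⁻¹) (a : A) : lift f ρ h1 h2 ⟨a, -1⟩ = f a * ρ := by
  simp [lift]

@[simp] theorem lift_refl (f : A →* H) (ρ : H) (h1 : ρ * ρ = 1)
    (h2 : ∀ a, ρ * f a * ρ = (f a)⁻¹) : lift f ρ h1 h2 refl = ρ := by
  rw [refl, lift_neg, map_one, one_mul]

theorem hom_ext {f g : GenDihedral A →* H} (h : f.comp inl = g.comp inl)
    (h' : f refl = g refl) : f = g := by
  ext ⟨a, s⟩
  have ha : f ⟨a, 1⟩ = g ⟨a, 1⟩ := DFunLike.congr_fun h a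
  rcases Int.units_eq_one_or s with rfl | rfl
  · exact ha
  · have : (⟨a, -1⟩ : GenDihedral A) = ⟨a, 1⟩ * refl := by simp [refl]
    rw [this, map_mul, map_mul, ha, h']

end Lift

/-- Functoriality of the generalised dihedral group. -/
def map {B : Type*} [CommGroup B] (f : A →* B) : GenDihedral A →* GenDihedral B where
  toFun p := ⟨f p.pt, p.sgn⟩
  map_one' := by simp [one_def]
  map_mul' := by
    rintro ⟨a, s⟩ ⟨b, t⟩
    simp

/-- Functoriality of the generalised dihedral group, for isomorphisms. -/
noncomputable def congr {B : Type*} [CommGroup B] (e : A ≃* B) : GenDihedral A ≃* GenDihedral B :=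
  MulEquiv.ofBijective (map e.toMonoidHom) <| by
    constructor
    · rintro ⟨a, s⟩ ⟨b, t⟩ h
      simpa [map] using h
    · rintro ⟨b, t⟩
      exact ⟨⟨e.symm b, t⟩, by simp [map]⟩

/-- The subgroup of rotations by elements of `L`. -/
def rot (L : Subgroup A) : Subgroup (GenDihedral A) := L.map inl

theorem mem_rot {L : Subgroup A} {a : A} {s : ℤˣ} :
    (⟨a, s⟩ : GenDihedral A) ∈ rot L ↔ s = 1 ∧ a ∈ L := by
  rw [rot, Subgroup.mem_map]
  constructor
  · rintro ⟨b, hb, h⟩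
    obtain ⟨rfl, rfl⟩ := GenDihedral.mk.inj h
    exact ⟨rfl, hb⟩
  · rintro ⟨rfl, h⟩
    exact ⟨a, h, rfl⟩

theorem index_rot (L : Subgroup A) : (rot L).index = 2 * L.index := by
  rw [rot, Subgroup.index_map_of_injective _ inl_injective, index_range_inl, mul_comm]

/-- The subgroup generated by the rotations by `L` and the reflections in the coset `c`. -/
def dih (L : Subgroup A) (c : A ⧸ L) : Subgroup (GenDihedral A) where
  carrier := {p | (p.sgn = 1 ∧ (p.pt : A ⧸ L) = 1) ∨ (p.sgn = -1 ∧ (p.pt : A ⧸ L) = c)}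
  one_mem' := Or.inl ⟨rfl, rfl⟩
  mul_mem' := by
    rintro ⟨a, s⟩ ⟨b, t⟩ (⟨h1 : s = 1, h2 : (a : A ⧸ L) = _⟩ | ⟨h1 : s = -1, h2 : (a : A ⧸ L) = _⟩)
      (⟨h3 : t = 1, h4 : (b : A ⧸ L) = _⟩ | ⟨h3 : t = -1, h4 : (b : A ⧸ L) = _⟩) <;>
    subst h1 h3
    · exact Or.inl ⟨rfl, by simp [h2, h4]⟩
    · exact Or.inr ⟨rfl, by simp [h2, h4]⟩
    · exact Or.inr ⟨rfl, by simp [h2, h4]⟩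
    · exact Or.inl ⟨rfl, by simp [h2, h4]⟩
  inv_mem' := by
    rintro ⟨a, s⟩ (⟨h1 : s = 1, h2 : (a : A ⧸ L) = _⟩ | ⟨h1 : s = -1, h2 : (a : A ⧸ L) = _⟩) <;>
    subst h1
    · exact Or.inl ⟨rfl, by simp [h2]⟩
    · exact Or.inr ⟨rfl, by simp [h2]⟩

theorem mk_one_mem_dih {L : Subgroup A} {c : A ⧸ L} {a : A} :
    (⟨a, 1⟩ : GenDihedral A) ∈ dih L c ↔ a ∈ L := by
  refine Iff.trans ?_ (QuotientGroup.eq_one_iff (N := L) a)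
  change (_ ∧ _) ∨ (_ ∧ _) ↔ _
  have : (1 : ℤˣ) ≠ -1 := by decide
  simp [this]

theorem mk_neg_mem_dih {L : Subgroup A} {c : A ⧸ L} {a : A} :
    (⟨a, -1⟩ : GenDihedral A) ∈ dih L c ↔ (a : A ⧸ L) = c := by
  change (_ ∧ _) ∨ (_ ∧ _) ↔ _
  have : (-1 : ℤˣ) ≠ 1 := by decide
  simp [this]

theorem comap_inl_dih (L : Subgroup A) (c : A ⧸ L) : (dih L c).comap inl = L := by
  ext a
  exact mk_one_mem_dih

theorem comap_inl_rot (L : Subgroup A) : (rot L).comap inl = L :=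
  Subgroup.comap_map_eq_self_of_injective inl_injective L

/-- A single reflection together with all rotations generates the whole group, so the index can be
computed inside the normal subgroup of rotations. -/
theorem index_dih (L : Subgroup A) (c : A ⧸ L) : (dih L c).index = L.index := by
  have : (inl : A →* GenDihedral A).range.Normal := range_inl (A := A) ▸ MonoidHom.normal_ker _
  have htop : (inl : A →* GenDihedral A).range ⊔ dih L c = ⊤ := by
    rw [eq_top_iff]
    rintro ⟨a, s⟩ -
    rcases Int.units_eq_one_or s with rfl | rfl
    · exact Subgroup.mem_sup_left ⟨a, rfl⟩
    · obtain ⟨v, rfl⟩ := QuotientGroup.mk_surjective c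
      have : (⟨a, -1⟩ : GenDihedral A) = ⟨a * v⁻¹, 1⟩ * ⟨v, -1⟩ := by simp
      rw [this]
      exact Subgroup.mul_mem_sup ⟨_, rfl⟩ (mk_neg_mem_dih.2 rfl)
  conv_rhs => rw [← comap_inl_dih L c, Subgroup.index_comap, ← Subgroup.relIndex_sup_of_normal,
    htop, Subgroup.relIndex_top_right]

theorem exists_eq_rot_or_dih (H : Subgroup (GenDihedral A)) :
    (∃ L, rot L = H) ∨ ∃ L c, dih L c = H := by
  by_cases h : ∃ v, (⟨v, -1⟩ : GenDihedral A) ∈ H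
  · obtain ⟨v, hv⟩ := h
    refine Or.inr ⟨H.comap inl, (v : A ⧸ _), ?_⟩
    ext ⟨a, s⟩
    rcases Int.units_eq_one_or s with rfl | rfl
    · exact mk_one_mem_dih
    · have : (⟨a, -1⟩ : GenDihedral A) = ⟨v, -1⟩ * ⟨a⁻¹ * v, 1⟩ := by simp
      rw [mk_neg_mem_dih, QuotientGroup.eq, this, Subgroup.mul_mem_cancel_left _ hv]
      rfl
  · refine Or.inl ⟨H.comap inl, ?_⟩
    ext ⟨a, s⟩
    rw [mem_rot]
    rcases Int.units_eq_one_or s with rfl | rfl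
    · simp
    · have : (-1 : ℤˣ) ≠ 1 := by decide
      simp only [this, false_and, false_iff]
      exact fun h' => h ⟨a, h'⟩

theorem rot_ne_dih (L M : Subgroup A) (c : A ⧸ M) : rot L ≠ dih M c := by
  intro h
  obtain ⟨v, rfl⟩ := QuotientGroup.mk_surjective c
  have : (⟨v, -1⟩ : GenDihedral A) ∈ rot L := h ▸ mk_neg_mem_dih.2 rfl
  exact absurd (mem_rot.1 this).1 (by decide)

theorem rot_injective : Function.Injective (rot : Subgroup A → Subgroup (GenDihedral A)) :=
  fun L M h => by rw [← comap_inl_rot L, h, comap_inl_rot]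

theorem dih_injective (L : Subgroup A) : Function.Injective (dih L) := by
  intro c d h
  obtain ⟨v, rfl⟩ := QuotientGroup.mk_surjective c
  have : (⟨v, -1⟩ : GenDihedral A) ∈ dih L d := h ▸ mk_neg_mem_dih.2 rfl
  exact mk_neg_mem_dih.1 this

/-- The classification of subgroups of given index. -/
noncomputable def subgroupEquiv (k : ℕ) :
    ({L : Subgroup A // 2 * L.index = k} ⊕ Σ L : {L : Subgroup A // L.index = k}, A ⧸ L.1) ≃
      {H : Subgroup (GenDihedral A) // H.index = k} :=
  Equiv.ofBijective (Sum.elim (fun L => ⟨rot L.1, (index_rot _).trans L.2⟩)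
    fun t => ⟨dih t.1.1 t.2, (index_dih _ _).trans t.1.2⟩) <| by
    constructor
    · rintro (⟨L, hL⟩ | ⟨⟨L, hL⟩, c⟩) (⟨M, hM⟩ | ⟨⟨M, hM⟩, d⟩) h
      · have h : rot L = rot M := congrArg Subtype.val h
        obtain rfl := rot_injective h
        rfl
      · exact (rot_ne_dih _ _ _ (congrArg Subtype.val h)).elim
      · exact (rot_ne_dih _ _ _ (congrArg Subtype.val h).symm).elim
      · have h : dih L c = dih M d := congrArg Subtype.val h
        obtain rfl : L = M := by rw [← comap_inl_dih L c, h, comap_inl_dih]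
        obtain rfl := dih_injective _ h
        rfl
    · rintro ⟨H, hH⟩
      rcases exists_eq_rot_or_dih H with ⟨L, rfl⟩ | ⟨L, c, rfl⟩
      · exact ⟨Sum.inl ⟨L, (index_rot _).symm.trans hH⟩, rfl⟩
      · exact ⟨Sum.inr ⟨⟨L, (index_dih _ _).symm.trans hH⟩, c⟩, rfl⟩

/-- The rotation subgroup is isomorphic to `L`. -/
noncomputable def rotEquiv (L : Subgroup A) : L ≃* rot L :=
  L.equivMapOfInjective inl inl_injective

/-- Change of origin: a reflection `⟨v, -1⟩` from the coset plays the role of the basic reflection.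
-/
theorem nonempty_dih_equiv (L : Subgroup A) (c : A ⧸ L) :
    Nonempty (GenDihedral L ≃* dih L c) := by
  obtain ⟨v, rfl⟩ := QuotientGroup.mk_surjective c
  let f : GenDihedral L →* GenDihedral A :=
    lift (inl.comp L.subtype) ⟨v, -1⟩ (by simp) (by rintro ⟨a, ha⟩; simp [mul_comm])
  have h1 : ∀ a : L, f ⟨a, 1⟩ = ⟨a, 1⟩ := fun a => lift_inl _ _ _ _ a
  have h2 : ∀ a : L, f ⟨a, -1⟩ = ⟨a * v, -1⟩ := fun a => (lift_neg _ _ _ _ a).trans (by simp)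
  have hf : Function.Injective f := by
    rw [injective_iff_map_eq_one]
    rintro ⟨a, s⟩ h
    rcases Int.units_eq_one_or s with rfl | rfl
    · rw [h1] at h
      simpa using h
    · rw [h2, mk_eq_one] at h
      exact absurd h.2 (by decide)
  have hr : f.range = dih L v := by
    ext ⟨a, s⟩
    rcases Int.units_eq_one_or s with rfl | rfl
    · rw [mk_one_mem_dih]
      constructor
      · rintro ⟨⟨b, t⟩, h⟩
        rcases Int.units_eq_one_or t with rfl | rfl
        · rw [h1] at h
          rw [← (GenDihedral.mk.inj h).1]
          exact b.2
        · rw [h2] at h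
          exact absurd (GenDihedral.mk.inj h).2 (by decide)
      · intro h
        exact ⟨⟨⟨a, h⟩, 1⟩, h1 _⟩
    · rw [mk_neg_mem_dih, eq_comm, QuotientGroup.eq]
      constructor
      · rintro ⟨⟨b, t⟩, h⟩
        rcases Int.units_eq_one_or t with rfl | rfl
        · rw [h1] at h
          exact absurd (GenDihedral.mk.inj h).2 (by decide)
        · rw [h2] at h
          rw [← (GenDihedral.mk.inj h).1]
          simp
      · intro h
        exact ⟨⟨⟨_, h⟩, -1⟩, (h2 _).trans (by simp [mul_comm])⟩
  exact ⟨(MonoidHom.ofInjective hf).trans (MulEquiv.subgroupCongr hr)⟩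

theorem rot_eq_ker (L : Subgroup A) : rot L = (map (QuotientGroup.mk' L)).ker := by
  ext ⟨a, s⟩
  rw [mem_rot, MonoidHom.mem_ker]
  simp [map, and_comm]

instance (L : Subgroup A) : (rot L).Normal := rot_eq_ker L ▸ MonoidHom.normal_ker _

theorem nonempty_normalizerQuotient_rot (L : Subgroup A) :
    Nonempty (NormalizerQuotient (rot L) ≃* GenDihedral (A ⧸ L)) := by
  let f := (map (QuotientGroup.mk' L)).comp
    (Subgroup.normalizer (rot L : Set (GenDihedral A))).subtype
  have hf : Function.Surjective f := by
    rintro ⟨c, s⟩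
    obtain ⟨v, rfl⟩ := QuotientGroup.mk_surjective c
    exact ⟨⟨⟨v, s⟩, by rw [Subgroup.normalizer_eq_top]; exact Subgroup.mem_top _⟩, rfl⟩
  have hk : (rot L).subgroupOf (Subgroup.normalizer (rot L : Set (GenDihedral A))) = f.ker := by
    rw [← MonoidHom.comap_ker, ← rot_eq_ker]
    rfl
  exact ⟨(QuotientGroup.quotientMulEquivOfEq hk).trans
    (QuotientGroup.quotientKerEquivOfSurjective f hf)⟩

/-- Conjugation by the rotation a multiplies the coset of reflections by a², so a rotation
normalizes exactly when a² ∈ L. The given reflections normalize too, which fixes the reflection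
coset of the normalizer. -/
theorem normalizer_dih (L : Subgroup A) (v : A) :
    Subgroup.normalizer (dih L (QuotientGroup.mk v) : Set (GenDihedral A)) =
      dih (L.comap (powMonoidHom 2)) (QuotientGroup.mk v) := by
  have hv : (⟨v, -1⟩ : GenDihedral A) ∈ dih L (QuotientGroup.mk v) := mk_neg_mem_dih.2 rfl
  ext ⟨a, s⟩
  rw [Subgroup.mem_normalizer_iff]
  rcases Int.units_eq_one_or s with rfl | rfl
  · have h1 : ∀ x : A, (⟨a, 1⟩ * ⟨x, 1⟩ * ⟨a, 1⟩⁻¹ : GenDihedral A) = ⟨x, 1⟩ := fun x => by simp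
    have h2 : ∀ x : A, (⟨a, 1⟩ * ⟨x, -1⟩ * ⟨a, 1⟩⁻¹ : GenDihedral A) = ⟨a ^ 2 * x, -1⟩ :=
      fun x => by simp [pow_two, mul_right_comm]
    rw [mk_one_mem_dih, Subgroup.mem_comap, powMonoidHom_apply, ← QuotientGroup.eq_one_iff]
    constructor
    · intro h
      have := (h _).1 hv
      rw [h2, mk_neg_mem_dih, QuotientGroup.mk_mul] at this
      simpa using this
    · rintro h ⟨x, t⟩
      rcases Int.units_eq_one_or t with rfl | rfl
      · rw [h1]
      · rw [h2, mk_neg_mem_dih, mk_neg_mem_dih, QuotientGroup.mk_mul, h, one_mul]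
  · have h1 : ∀ x : A, (⟨a, -1⟩ * ⟨x, 1⟩ * ⟨a, -1⟩⁻¹ : GenDihedral A) = ⟨x⁻¹, 1⟩ := fun x => by
      simp [mul_right_comm]
    have h2 : ∀ x : A, (⟨a, -1⟩ * ⟨x, -1⟩ * ⟨a, -1⟩⁻¹ : GenDihedral A) = ⟨a ^ 2 * x⁻¹, -1⟩ :=
      fun x => by simp [pow_two, mul_right_comm]
    rw [mk_neg_mem_dih, eq_comm, QuotientGroup.eq, Subgroup.mem_comap, powMonoidHom_apply,
      mul_pow, inv_pow, ← QuotientGroup.eq]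
    constructor
    · intro h
      have := (h _).1 hv
      rw [h2, mk_neg_mem_dih, QuotientGroup.mk_mul, QuotientGroup.mk_inv, mul_inv_eq_iff_eq_mul,
        ← QuotientGroup.mk_mul] at this
      rw [pow_two v]
      exact this.symm
    · rintro h ⟨x, t⟩
      rcases Int.units_eq_one_or t with rfl | rfl
      · rw [h1, mk_one_mem_dih, mk_one_mem_dih, inv_mem_iff]
      · rw [h2, mk_neg_mem_dih, mk_neg_mem_dih, QuotientGroup.mk_mul, ← h, QuotientGroup.mk_pow,
          QuotientGroup.mk_inv, mul_inv_eq_iff_eq_mul, pow_two, mul_right_inj, eq_comm]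

/-- The subgroup and its normalizer are both of the form `dih`, and `index_dih` reduces the relative
index to one between lattices. -/
theorem card_normalizerQuotient_dih (L : Subgroup A) (c : A ⧸ L) (hL : L.index ≠ 0) :
    Nat.card (NormalizerQuotient (dih L c)) = L.relIndex (L.comap (powMonoidHom 2)) := by
  obtain ⟨v, rfl⟩ := QuotientGroup.mk_surjective c
  have hle : L ≤ L.comap (powMonoidHom 2) := fun a ha => pow_mem ha 2
  have h1 := Subgroup.relIndex_mul_index hle
  have h2 := Subgroup.relIndex_mul_index (Subgroup.le_normalizer (H := dih L (QuotientGroup.mk v)))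
  rw [index_dih, normalizer_dih, index_dih, ← h1] at h2
  change (dih L (QuotientGroup.mk v)).relIndex _ = _
  rw [normalizer_dih]
  -- Cancelling the index of the larger lattice requires it to be nonzero, which follows from `hL`.
  refine Nat.eq_of_mul_eq_mul_right (Nat.pos_of_ne_zero fun h => hL ?_) h2
  rw [← h1, h, mul_zero]

end GenDihedral

/-! ### Finiteness and invariance of sets of homomorphisms. -/

section HomFinite

variable {A B : Type*} [Group A] [Group B]

theorem HomFinite.of_mulEquiv (e : A ≃* B) (h : HomFinite A) : HomFinite B := by
  intro Q _ _
  have := h Q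
  refine Finite.of_injective (fun f : B →* Q => f.comp e.toMonoidHom) fun f g hfg => ?_
  ext b
  simpa using DFunLike.congr_fun hfg (e.symm b)

theorem HomFinite.genDihedral {A : Type*} [CommGroup A] (h : HomFinite A) :
    HomFinite (GenDihedral A) := by
  intro Q _ _
  have := h Q
  refine Finite.of_injective (fun f : GenDihedral A →* Q => (f.comp GenDihedral.inl,
    f GenDihedral.refl)) fun f g hfg => ?_
  exact GenDihedral.hom_ext (congrArg Prod.fst hfg) (congrArg Prod.snd hfg)

theorem Nat.card_monoidHom_congr {A' : Type*} {Q Q' : Type*} [Group A'] [Group Q] [Group Q']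
    (e : A ≃* A') (e' : Q ≃* Q') : Nat.card (A →* Q) = Nat.card (A' →* Q') := by
  refine Nat.card_congr ⟨fun f => (e'.toMonoidHom.comp f).comp e.symm.toMonoidHom,
    fun f => (e'.symm.toMonoidHom.comp f).comp e.toMonoidHom, fun f => ?_, fun f => ?_⟩
  · ext x; simp
  · ext x; simp

end HomFinite

/-! ### Finite-index subgroups of ℤ and ℤ². -/

section Free

/-- Over ℤ, a submodule of a finite free module is free, and a finite quotient forces equal rank. -/
theorem Subgroup.nonempty_mulEquiv_of_free {G : Type*} [CommGroup G]
    [Module.Free ℤ (Additive G)] [Module.Finite ℤ (Additive G)] (L : Subgroup G)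
    (hL : L.index ≠ 0) : Nonempty (L ≃* G) := by
  let N : Submodule ℤ (Additive G) := AddSubgroup.toIntSubmodule (Subgroup.toAddSubgroup L)
  have hfin : Finite (Additive G ⧸ N) := by
    have : (Subgroup.toAddSubgroup L).index ≠ 0 := by
      rwa [Subgroup.index_toAddSubgroup]
    exact AddSubgroup.index_ne_zero_iff_finite.1 this
  have hr := (Submodule.finiteQuotient_iff N).1 hfin
  obtain ⟨e⟩ := FiniteDimensional.nonempty_linearEquiv_of_finrank_eq hr
  exact ⟨⟨⟨fun x => (e ⟨Additive.ofMul x.1, x.2⟩).toMul,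
    fun y => ⟨(e.symm (Additive.ofMul y)).1.toMul, (e.symm (Additive.ofMul y)).2⟩,
    fun x => by ext; simp, fun y => by simp⟩, fun x y => by
      exact congrArg Additive.toMul (map_add e (⟨Additive.ofMul x.1, x.2⟩ : N) ⟨Additive.ofMul y.1, y.2⟩)⟩⟩

/-- The infinite cyclic group. -/
abbrev InfCyclic : Type := Multiplicative ℤ

/-- The free abelian group of rank two. -/
abbrev FreeAbTwo : Type := InfCyclic × InfCyclic

instance : Module.Free ℤ (Additive InfCyclic) := inferInstanceAs (Module.Free ℤ ℤ)

instance : Module.Finite ℤ (Additive InfCyclic) := inferInstanceAs (Module.Finite ℤ ℤ)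

instance : Module.Free ℤ (Additive FreeAbTwo) :=
  Module.Free.of_equiv (AddEquiv.prodAdditive InfCyclic InfCyclic).symm.toIntLinearEquiv

instance : Module.Finite ℤ (Additive FreeAbTwo) :=
  Module.Finite.equiv (AddEquiv.prodAdditive InfCyclic InfCyclic).symm.toIntLinearEquiv

theorem homFinite_infCyclic : HomFinite InfCyclic := by
  intro Q _ _
  exact Finite.of_equiv _ (zpowersHom Q)

theorem freeAbTwo_hom_ext {H : Type*} [Group H] {f g : FreeAbTwo →* H}
    (h1 : f (Multiplicative.ofAdd 1, 1) = g (Multiplicative.ofAdd 1, 1))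
    (h2 : f (1, Multiplicative.ofAdd 1) = g (1, Multiplicative.ofAdd 1)) : f = g := by
  have e1 : f.comp (MonoidHom.inl _ _) = g.comp (MonoidHom.inl _ _) := MonoidHom.ext_mint h1
  have e2 : f.comp (MonoidHom.inr _ _) = g.comp (MonoidHom.inr _ _) := MonoidHom.ext_mint h2
  ext ⟨a, b⟩
  have : ((a, b) : FreeAbTwo) = (a, 1) * (1, b) := by simp
  rw [this, map_mul, map_mul]
  exact congrArg₂ (· * ·) (DFunLike.congr_fun e1 a) (DFunLike.congr_fun e2 b)

theorem homFinite_freeAbTwo : HomFinite FreeAbTwo := by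
  intro Q _ _
  have := homFinite_infCyclic Q
  refine Finite.of_injective (fun f : FreeAbTwo →* Q => (f.comp (MonoidHom.inl _ _),
    f.comp (MonoidHom.inr _ _))) fun f g hfg => ?_
  exact freeAbTwo_hom_ext (DFunLike.congr_fun (congrArg Prod.fst hfg) (Multiplicative.ofAdd 1))
    (DFunLike.congr_fun (congrArg Prod.snd hfg) (Multiplicative.ofAdd 1))

theorem card_subgroups_infCyclic (k : ℕ) :
    Nat.card {L : Subgroup InfCyclic // L.index = k} = 1 := by
  rw [Nat.card_eq_one_iff_exists]
  refine ⟨⟨AddSubgroup.toSubgroup (AddSubgroup.zmultiples (k : ℤ)), ?_⟩, ?_⟩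
  · rw [AddSubgroup.index_toSubgroup, Int.index_zmultiples, Int.natAbs_natCast]
  · rintro ⟨L, hL⟩
    obtain ⟨M, rfl⟩ := AddSubgroup.toSubgroup.surjective L
    obtain ⟨a, rfl⟩ := Int.subgroup_cyclic M
    rw [← AddSubgroup.zmultiples_eq_closure, AddSubgroup.index_toSubgroup,
      Int.index_zmultiples] at hL
    rw [Subtype.mk.injEq, ← AddSubgroup.zmultiples_eq_closure, ← hL, Int.zmultiples_natAbs]

theorem finite_subgroups_infCyclic (k : ℕ) :
    Finite {L : Subgroup InfCyclic // L.index = k} :=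
  Nat.finite_of_card_ne_zero (by rw [card_subgroups_infCyclic]; exact one_ne_zero)

theorem homFinite_of_index_infCyclic (L : Subgroup InfCyclic) (hL : L.index ≠ 0) : HomFinite L := by
  obtain ⟨e⟩ := L.nonempty_mulEquiv_of_free hL
  exact homFinite_infCyclic.of_mulEquiv e.symm

theorem homFinite_of_index_freeAbTwo (L : Subgroup FreeAbTwo) (hL : L.index ≠ 0) :
    HomFinite L := by
  obtain ⟨e⟩ := L.nonempty_mulEquiv_of_free hL
  exact homFinite_freeAbTwo.of_mulEquiv e.symm

theorem finite_subgroups_freeAbTwo {k : ℕ} (hk : 0 < k) :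
    Finite {L : Subgroup FreeAbTwo // L.index = k} :=
  finite_subgroups_prod (fun k _ => finite_subgroups_infCyclic k)
    (fun k _ => finite_subgroups_infCyclic k) homFinite_of_index_infCyclic hk

theorem finsum_const_eq {ι : Type*} [Finite ι] (f : ι → ℕ) (c : ℕ) (h : ∀ i, f i = c) :
    ∑ᶠ i, f i = Nat.card ι * c := by
  have := Fintype.ofFinite ι
  rw [finsum_eq_sum_of_fintype, Finset.sum_congr rfl fun i _ => h i, Finset.sum_const,
    Finset.card_univ, smul_eq_mul, Nat.card_eq_fintype_card]

/-- Goursat for ℤ × ℤ: each factorisation k = ij has one A and one K, and since A ≅ ℤ there are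
|ℤ/j| = j homomorphisms. -/
theorem numSubgroupsOfIndex_freeAbTwo {k : ℕ} (hk : 0 < k) :
    numSubgroupsOfIndex FreeAbTwo k = σ 1 k := by
  rw [numSubgroupsOfIndex_prod (fun k _ => finite_subgroups_infCyclic k)
    (fun k _ => finite_subgroups_infCyclic k) homFinite_of_index_infCyclic hk,
    ArithmeticFunction.sigma_one_apply, ← Nat.sum_divisorsAntidiagonal' fun _ j => j]
  refine Finset.sum_congr rfl fun p hp => ?_
  obtain ⟨h1, h2⟩ := Nat.ne_zero_of_mem_divisorsAntidiagonal hp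
  have := finite_subgroups_infCyclic p.1
  have := finite_subgroups_infCyclic p.2
  have key : ∀ (A : {A : Subgroup InfCyclic // A.index = p.1})
      (K : {K : Subgroup InfCyclic // K.index = p.2}),
      Nat.card (A.1 →* NormalizerQuotient K.1) = p.2 := by
    intro A K
    obtain ⟨e⟩ := A.1.nonempty_mulEquiv_of_free (A.2.trans_ne h1)
    rw [Nat.card_monoidHom_congr e (MulEquiv.refl _), ← Nat.card_congr (zpowersHom _)]
    change K.1.relIndex _ = _
    rw [Subgroup.normalizer_eq_top, Subgroup.relIndex_top_right, K.2]
  rw [finsum_const_eq _ p.2, card_subgroups_infCyclic, one_mul]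
  intro A
  rw [finsum_const_eq _ p.2 (key A), card_subgroups_infCyclic, one_mul]

end Free

/-! ### Summation over the subgroups of given index. -/

namespace GenDihedral

variable {A : Type*} [CommGroup A]

theorem card_two_mul_index (k : ℕ) :
    Nat.card {L : Subgroup A // 2 * L.index = k} =
      if 2 ∣ k then numSubgroupsOfIndex A (k / 2) else 0 := by
  split_ifs with h
  · obtain ⟨m, rfl⟩ := h
    rw [numSubgroupsOfIndex_eq_card]
    exact Nat.card_congr (Equiv.subtypeEquivRight fun L => by omega)
  · rw [Nat.card_eq_zero]
    exact Or.inl ⟨fun L => h ⟨_, L.2.symm⟩⟩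

theorem finite_two_mul_index (hA : ∀ k, 0 < k → Finite {L : Subgroup A // L.index = k})
    {k : ℕ} (hk : 0 < k) : Finite {L : Subgroup A // 2 * L.index = k} := by
  by_cases h : 2 ∣ k
  · obtain ⟨m, rfl⟩ := h
    have := hA m (by omega)
    exact Finite.of_equiv _ (Equiv.subtypeEquivRight fun L => by omega :
      {L : Subgroup A // L.index = m} ≃ {L : Subgroup A // 2 * L.index = 2 * m})
  · exact @Finite.of_subsingleton _ ⟨fun L => (h ⟨_, L.2.symm⟩).elim⟩

theorem finite_quotient_of_index {k : ℕ} (hk : 0 < k) (L : {L : Subgroup A // L.index = k}) :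
    Finite (A ⧸ L.1) :=
  Subgroup.index_ne_zero_iff_finite.1 (L.2.trans_ne hk.ne')

theorem finite_subgroups (hA : ∀ k, 0 < k → Finite {L : Subgroup A // L.index = k})
    {k : ℕ} (hk : 0 < k) : Finite {H : Subgroup (GenDihedral A) // H.index = k} := by
  have := finite_two_mul_index hA hk
  have := hA k hk
  have := finite_quotient_of_index (A := A) hk
  exact Finite.of_equiv _ (subgroupEquiv k)

/-- Used for f constant on each of the two types of subgroup. The factor k in the second term counts
the cosets of a lattice of index k. -/
theorem finsum_subgroups (hA : ∀ k, 0 < k → Finite {L : Subgroup A // L.index = k})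
    {k : ℕ} (hk : 0 < k) (f : Subgroup (GenDihedral A) → ℕ) (x y : ℕ)
    (hx : ∀ L, 2 * L.index = k → f (rot L) = x) (hy : ∀ L c, L.index = k → f (dih L c) = y) :
    ∑ᶠ H : {H : Subgroup (GenDihedral A) // H.index = k}, f H.1 =
      (if 2 ∣ k then numSubgroupsOfIndex A (k / 2) else 0) * x + k * numSubgroupsOfIndex A k * y := by
  have := finite_two_mul_index hA hk
  have := hA k hk
  have := finite_quotient_of_index (A := A) hk
  have := Fintype.ofFinite {L : Subgroup A // 2 * L.index = k}
  have := Fintype.ofFinite {L : Subgroup A // L.index = k}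
  have := fun L : {L : Subgroup A // L.index = k} => Fintype.ofFinite (A ⧸ L.1)
  rw [← finsum_comp_equiv (subgroupEquiv k), finsum_eq_sum_of_fintype, Fintype.sum_sum_type,
    Fintype.sum_sigma, ← card_two_mul_index]
  have h1 : ∀ L : {L : Subgroup A // 2 * L.index = k}, f (subgroupEquiv k (Sum.inl L)).1 = x :=
    fun L => hx L.1 L.2
  have h2 : ∀ (L : {L : Subgroup A // L.index = k}) (c : A ⧸ L.1),
      f (subgroupEquiv k (Sum.inr ⟨L, c⟩)).1 = y := fun L c => hy L.1 c L.2
  have h3 : ∀ L : {L : Subgroup A // L.index = k}, Fintype.card (A ⧸ L.1) = k := fun L => by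
    rw [← Nat.card_eq_fintype_card, ← Subgroup.index_eq_card, L.2]
  simp only [h1, h2, Finset.sum_const, Finset.card_univ, smul_eq_mul, h3,
    numSubgroupsOfIndex_eq_card, Nat.card_eq_fintype_card]
  ring

theorem homFinite_of_index (hA : ∀ L : Subgroup A, L.index ≠ 0 → HomFinite L)
    (H : Subgroup (GenDihedral A)) (hH : H.index ≠ 0) : HomFinite H := by
  rcases exists_eq_rot_or_dih H with ⟨L, rfl⟩ | ⟨L, c, rfl⟩
  · rw [index_rot] at hH
    exact (hA L fun h => hH (by rw [h])).of_mulEquiv (rotEquiv L)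
  · rw [index_dih] at hH
    obtain ⟨e⟩ := nonempty_dih_equiv L c
    exact (hA L hH).genDihedral.of_mulEquiv e

end GenDihedral

/-! ### Counting homomorphisms from ℤ² and p2 into generalised dihedral groups. -/

/-- Template for the counts below: after the change of variables e, the condition separates into
independent conditions on the coordinates. -/
theorem Nat.card_subtype_of_equiv_prod {α β γ δ : Type*} (e : α × β × γ ≃ δ)
    (P : δ → Prop) (p : α → Prop) (q : β → Prop) (r : γ → Prop)
    (h : ∀ a b c, P (e (a, b, c)) ↔ p a ∧ q b ∧ r c) :
    Nat.card {x // P x} = Nat.card {a // p a} * (Nat.card {b // q b} * Nat.card {c // r c}) := by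
  rw [← Nat.card_prod, ← Nat.card_prod]
  refine Nat.card_congr (Equiv.symm ?_)
  refine Equiv.trans ?_ (e.subtypeEquiv (p := fun x => p x.1 ∧ q x.2.1 ∧ r x.2.2)
    fun x => (h x.1 x.2.1 x.2.2).symm)
  exact ((Equiv.refl _).prodCongr Equiv.subtypeProdEquivProd.symm).trans
    Equiv.subtypeProdEquivProd.symm

/-- The homomorphism from the free abelian group of rank two given by a commuting pair. -/
def freeAbTwoLift {H : Type*} [Group H] (x z : H) (h : x * z = z * x) : FreeAbTwo →* H :=
  MonoidHom.noncommCoprod (zpowersHom H x) (zpowersHom H z) fun m n => by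
    rw [zpowersHom_apply, zpowersHom_apply]
    exact Commute.zpow_zpow h _ _

@[simp] theorem freeAbTwoLift_fst {H : Type*} [Group H] (x z : H) (h : x * z = z * x) :
    freeAbTwoLift x z h (Multiplicative.ofAdd 1, 1) = x := by
  simp [freeAbTwoLift, MonoidHom.noncommCoprod]

@[simp] theorem freeAbTwoLift_snd {H : Type*} [Group H] (x z : H) (h : x * z = z * x) :
    freeAbTwoLift x z h (1, Multiplicative.ofAdd 1) = z := by
  simp [freeAbTwoLift, MonoidHom.noncommCoprod]

theorem freeAbTwoLift_apply {H : Type*} [Group H] (x z : H) (h : x * z = z * x) (a b : InfCyclic) :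
    freeAbTwoLift x z h (a, b) = x ^ a.toAdd * z ^ b.toAdd := rfl

/-- Homomorphisms from the free abelian group of rank two are commuting pairs. -/
def freeAbTwoHomEquiv (H : Type*) [Group H] :
    (FreeAbTwo →* H) ≃ {p : H × H // p.1 * p.2 = p.2 * p.1} where
  toFun f := ⟨(f (Multiplicative.ofAdd 1, 1), f (1, Multiplicative.ofAdd 1)), by
    rw [← map_mul, ← map_mul, mul_comm]⟩
  invFun p := freeAbTwoLift p.1.1 p.1.2 p.2
  left_inv f := freeAbTwo_hom_ext (freeAbTwoLift_fst _ _ _) (freeAbTwoLift_snd _ _ _)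
  right_inv p := Subtype.ext (Prod.ext (freeAbTwoLift_fst _ _ p.2) (freeAbTwoLift_snd _ _ p.2))

namespace GenDihedral

/-- The homomorphism given by three involutions whose product is an involution. -/
def involutionLift {H : Type*} [Group H] (x r z : H) (hx : x * x = 1) (hr : r * r = 1)
    (hz : z * z = 1) (h : x * r * z * (x * r * z) = 1) : GenDihedral FreeAbTwo →* H :=
  have ix : x⁻¹ = x := inv_eq_of_mul_eq_one_left hx
  have ir : r⁻¹ = r := inv_eq_of_mul_eq_one_left hr
  have iz : z⁻¹ = z := inv_eq_of_mul_eq_one_left hz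
  -- As xrz is an involution it equals its inverse zrx; this says precisely that the future
  -- translations rx and rz commute.
  have hc : r * x * (r * z) = r * z * (r * x) := by
    have h1 : x * r * z = z * r * x := by
      rw [← inv_eq_of_mul_eq_one_left h, mul_inv_rev, mul_inv_rev, ix, ir, iz, mul_assoc]
    calc r * x * (r * z) = r * (x * r * z) := by group
      _ = r * (z * r * x) := by rw [h1]
      _ = r * z * (r * x) := by group
  lift (freeAbTwoLift (r * x) (r * z) hc) r hr <| by
    have conj : ∀ w, w * w = 1 → r * (r * w) * r = (r * w)⁻¹ := fun w hw => by
      rw [mul_inv_rev, ir, inv_eq_of_mul_eq_one_left hw, ← mul_assoc, hr, one_mul]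
    rintro ⟨a, b⟩
    have hconj : ∀ y, r * y * r = MulAut.conj r y := fun y => by rw [MulAut.conj_apply, ir]
    rw [freeAbTwoLift_apply, hconj, map_mul, map_zpow, map_zpow, ← hconj, ← hconj, conj x hx, conj z hz, inv_zpow,
      inv_zpow, ← mul_inv_rev, inv_inj]
    exact (Commute.zpow_zpow hc _ _).symm

/-- Homomorphisms from the plane group `p2` are triples of involutions with involutory product. -/
theorem card_hom_genDihedral (H : Type*) [Group H] :
    Nat.card (GenDihedral FreeAbTwo →* H) = Nat.card {p : H × H × H //
      p.1 * p.1 = 1 ∧ p.2.1 * p.2.1 = 1 ∧ p.2.2 * p.2.2 = 1 ∧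
        p.1 * p.2.1 * p.2.2 * (p.1 * p.2.1 * p.2.2) = 1} := by
  -- Every element of sign -1 is an involution, and so is any product of three of them, since it
  -- again has sign -1.
  have hsq : ∀ (f : GenDihedral FreeAbTwo →* H) p, p.sgn = -1 → f p * f p = 1 := by
    rintro f ⟨a, s⟩ (rfl : s = -1)
    rw [← map_mul, mk_mul_mk]
    simp [← one_def]
  have hsq' : ∀ (f : GenDihedral FreeAbTwo →* H) p q r, p.sgn = -1 → q.sgn = -1 → r.sgn = -1 →
      f p * f q * f r * (f p * f q * f r) = 1 := fun f p q r hp hq hr => by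
    rw [← map_mul, ← map_mul]
    refine hsq f _ ?_
    change p.sgn * q.sgn * r.sgn = -1
    rw [hp, hq, hr]
    decide
  refine Nat.card_congr (Equiv.ofBijective (fun f => ⟨(f (refl * ⟨(Multiplicative.ofAdd 1, 1), 1⟩),
    f refl, f (refl * ⟨(1, Multiplicative.ofAdd 1), 1⟩)), hsq f _ rfl, hsq f _ rfl, hsq f _ rfl,
    hsq' f _ _ _ rfl rfl rfl⟩) ⟨?_, ?_⟩)
  · intro f g h
    obtain ⟨h1, h2⟩ := Prod.ext_iff.1 (congrArg Subtype.val h)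
    obtain ⟨h2, h3⟩ := Prod.ext_iff.1 h2
    replace h2 : f refl = g refl := h2
    replace h1 : f (refl * _) = g (refl * _) := h1
    replace h3 : f (refl * _) = g (refl * _) := h3
    rw [map_mul, map_mul, h2, mul_right_inj] at h1 h3
    exact hom_ext (freeAbTwo_hom_ext h1 h3) h2
  · rintro ⟨⟨x, r, z⟩, hx, hr, hz, h⟩
    have hr : r * r = 1 := hr
    refine ⟨involutionLift x r z hx hr hz h, Subtype.ext (Prod.ext ?_ (Prod.ext ?_ ?_))⟩
    · change involutionLift x r z hx hr hz h (_ * _) = x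
      rw [map_mul, involutionLift, lift_refl, lift_inl, freeAbTwoLift_fst, ← mul_assoc, hr, one_mul]
    · change involutionLift x r z hx hr hz h refl = r
      rw [involutionLift, lift_refl]
    · change involutionLift x r z hx hr hz h (_ * _) = z
      rw [map_mul, involutionLift, lift_refl, lift_inl, freeAbTwoLift_snd, ← mul_assoc, hr, one_mul]

theorem card_subtype_pair {B : Type*} [Finite B] (P : GenDihedral B × GenDihedral B → Prop) :
    Nat.card {p // P p} = ∑ s : ℤˣ, ∑ t : ℤˣ,
      Nat.card {x : B × B // P (⟨x.1, s⟩, ⟨x.2, t⟩)} := by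
  let e : {p // P p} ≃ Σ s : ℤˣ × ℤˣ, {x : B × B // P (⟨x.1, s.1⟩, ⟨x.2, s.2⟩)} :=
    { toFun p := ⟨(p.1.1.sgn, p.1.2.sgn), (p.1.1.pt, p.1.2.pt), p.2⟩
      invFun t := ⟨(⟨t.2.1.1, t.1.1⟩, ⟨t.2.1.2, t.1.2⟩), t.2.2⟩
      left_inv _ := rfl
      right_inv _ := rfl }
  rw [Nat.card_congr e, Nat.card_sigma, Fintype.sum_prod_type]

theorem card_subtype_triple {B : Type*} [Finite B]
    (P : GenDihedral B × GenDihedral B × GenDihedral B → Prop) :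
    Nat.card {p // P p} = ∑ s : ℤˣ, ∑ t : ℤˣ, ∑ u : ℤˣ,
      Nat.card {x : B × B × B // P (⟨x.1, s⟩, ⟨x.2.1, t⟩, ⟨x.2.2, u⟩)} := by
  let e : {p // P p} ≃ Σ s : ℤˣ × ℤˣ × ℤˣ,
      {x : B × B × B // P (⟨x.1, s.1⟩, ⟨x.2.1, s.2.1⟩, ⟨x.2.2, s.2.2⟩)} :=
    { toFun p := ⟨(p.1.1.sgn, p.1.2.1.sgn, p.1.2.2.sgn), (p.1.1.pt, p.1.2.1.pt, p.1.2.2.pt), p.2⟩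
      invFun t := ⟨(⟨t.2.1.1, t.1.1⟩, ⟨t.2.1.2.1, t.1.2.1⟩, ⟨t.2.1.2.2, t.1.2.2⟩), t.2.2⟩
      left_inv _ := rfl
      right_inv _ := rfl }
  rw [Nat.card_congr e, Nat.card_sigma, Fintype.sum_prod_type]
  simp only [Fintype.sum_prod_type]

variable {B : Type*} [CommGroup B]

theorem sum_units_int (f : ℤˣ → ℕ) : ∑ s, f s = f 1 + f (-1) := by
  rw [UnitsInt.univ, Finset.sum_pair (by decide)]

/-- The number of solutions of `b² = 1` in `B`. -/
noncomputable def cardTwoTorsion (B : Type*) [CommGroup B] : ℕ := Nat.card {b : B // b * b = 1}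

/-- Commuting pairs, split by signs: two rotations always commute, which gives |B|². In each of the
other three cases one element, or a quotient of the two, must be 2-torsion while another coordinate
is free. -/
theorem card_hom_freeAbTwo [Finite B] : Nat.card (FreeAbTwo →* GenDihedral B) =
    Nat.card B ^ 2 + 3 * Nat.card B * cardTwoTorsion B := by
  let e : B × B × Unit ≃ B × B := (Equiv.refl B).prodCongr (Equiv.prodPUnit B)
  -- Two reflections a, b commute when ab⁻¹ is 2-torsion, so ab⁻¹ is taken as coordinate. The `Unit`
  -- factor only fits pairs to the three-coordinate template.
  let e1 : B × B × Unit ≃ B × B := e.trans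
    { toFun x := (x.1 * x.2, x.2)
      invFun x := (x.1 * x.2⁻¹, x.2)
      left_inv x := by simp
      right_inv x := by simp }
  rw [Nat.card_congr (freeAbTwoHomEquiv _), card_subtype_pair]
  simp only [sum_units_int]
  rw [Nat.card_subtype_of_equiv_prod e _ (fun _ => True) (fun _ => True) (fun _ => True),
    Nat.card_subtype_of_equiv_prod e _ (fun a => a * a = 1) (fun _ => True) (fun _ => True),
    Nat.card_subtype_of_equiv_prod e _ (fun _ => True) (fun a => a * a = 1) (fun _ => True),
    Nat.card_subtype_of_equiv_prod e1 _ (fun a => a * a = 1) (fun _ => True) (fun _ => True)]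
  · simp only [Nat.card_congr (Equiv.subtypeUnivEquiv fun _ => trivial), Nat.card_unique,
      cardTwoTorsion]
    ring
  all_goals intro a b c; simp [e, e1]
  · exact eq_inv_iff_mul_eq_one
  · rw [mul_comm b a, mul_right_inj, inv_eq_iff_mul_eq_one]
  · rw [mul_comm a b, mul_right_inj, eq_inv_iff_mul_eq_one]
  · exact mul_comm a b

/-- The eight sign patterns of a triple of square-one elements: three reflections are unconstrained
(|B|³), three rotations must be 2-torsion (t³). Each of the six mixed patterns leaves two 2-torsion
conditions and one free coordinate; for two reflections one condition is on their quotient, hence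
the shears `e1`, `e2`, `e3`. -/
theorem card_hom_genDihedral_freeAbTwo [Finite B] :
    Nat.card (GenDihedral FreeAbTwo →* GenDihedral B) =
      Nat.card B ^ 3 + 6 * Nat.card B * cardTwoTorsion B ^ 2 + cardTwoTorsion B ^ 3 := by
  let e1 : B × B × B ≃ B × B × B :=
    { toFun x := (x.1, x.2.1 * x.2.2, x.2.2)
      invFun x := (x.1, x.2.1 * x.2.2⁻¹, x.2.2)
      left_inv x := by simp
      right_inv x := by simp }
  let e2 : B × B × B ≃ B × B × B :=
    { toFun x := (x.1 * x.2.2, x.2.1, x.2.2)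
      invFun x := (x.1 * x.2.2⁻¹, x.2.1, x.2.2)
      left_inv x := by simp
      right_inv x := by simp }
  let e3 : B × B × B ≃ B × B × B :=
    { toFun x := (x.1 * x.2.1, x.2.1, x.2.2)
      invFun x := (x.1 * x.2.1⁻¹, x.2.1, x.2.2)
      left_inv x := by simp
      right_inv x := by simp }
  rw [card_hom_genDihedral, card_subtype_triple]
  simp only [sum_units_int]
  rw [Nat.card_subtype_of_equiv_prod (.refl _) _ (fun a : B => a * a = 1) (fun a : B => a * a = 1)
      (fun a : B => a * a = 1),
    Nat.card_subtype_of_equiv_prod (.refl _) _ (fun a : B => a * a = 1) (fun a : B => a * a = 1)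
      (fun _ : B => True),
    Nat.card_subtype_of_equiv_prod (.refl _) _ (fun a : B => a * a = 1) (fun _ : B => True)
      (fun a : B => a * a = 1),
    Nat.card_subtype_of_equiv_prod e1 _ (fun a : B => a * a = 1) (fun a : B => a * a = 1)
      (fun _ : B => True),
    Nat.card_subtype_of_equiv_prod (.refl _) _ (fun _ : B => True) (fun a : B => a * a = 1)
      (fun a : B => a * a = 1),
    Nat.card_subtype_of_equiv_prod e2 _ (fun a : B => a * a = 1) (fun a : B => a * a = 1)
      (fun _ : B => True),
    Nat.card_subtype_of_equiv_prod e3 _ (fun a : B => a * a = 1) (fun _ : B => True)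
      (fun a : B => a * a = 1),
    Nat.card_subtype_of_equiv_prod (.refl _) _ (fun _ : B => True) (fun _ : B => True)
      (fun _ : B => True)]
  · simp only [Nat.card_congr (Equiv.subtypeUnivEquiv fun _ => trivial), cardTwoTorsion]
    ring
  all_goals intro a b c; simp [e1, e2, e3]
  · rw [mul_mul_mul_comm]
    constructor <;> rintro ⟨h1, h2⟩ <;> simp_all
  · have h : a * c * b⁻¹ * c⁻¹ = a * b⁻¹ := by rw [mul_right_comm, mul_inv_cancel_right]
    rw [h, mul_mul_mul_comm, ← mul_inv]
    constructor <;> rintro ⟨h1, h2⟩ <;> simp_all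
  · intro h
    rw [← mul_assoc a b c, mul_inv_cancel_right, mul_mul_mul_comm, h, one_mul]
  · intro h1 h2 h3
    rw [mul_mul_mul_comm, mul_mul_mul_comm a, h1, h2, h3, one_mul, one_mul]

end GenDihedral

/-! ### The subgroup count as a sum over factorisations of n. -/

namespace GenDihedral

/-- The elements whose square lies in L map onto the 2-torsion of A/L, with kernel L. -/
theorem relIndex_comap_pow_two {A : Type*} [CommGroup A] (L : Subgroup A) :
    L.relIndex (L.comap (powMonoidHom 2)) = cardTwoTorsion (A ⧸ L) := by
  conv_lhs => rw [← QuotientGroup.ker_mk' L]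
  rw [Subgroup.relIndex_ker, cardTwoTorsion]
  refine Nat.card_congr (Equiv.subtypeEquivRight fun c => ?_)
  obtain ⟨a, rfl⟩ := QuotientGroup.mk_surjective c
  rw [Subgroup.mem_map]
  constructor
  · rintro ⟨b, hb, h⟩
    rw [← h, ← map_mul]
    rw [QuotientGroup.ker_mk', Subgroup.mem_comap, powMonoidHom_apply, pow_two] at hb
    exact (QuotientGroup.eq_one_iff _).2 hb
  · intro h
    refine ⟨a, ?_, rfl⟩
    rw [QuotientGroup.ker_mk', Subgroup.mem_comap, powMonoidHom_apply, pow_two]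
    exact (QuotientGroup.eq_one_iff _).1 h

theorem cardTwoTorsion_of_isCyclic (B : Type*) [CommGroup B] [IsCyclic B] [Finite B] :
    cardTwoTorsion B = (Nat.card B).gcd 2 := by
  rw [← IsCyclic.card_powMonoidHom_ker, cardTwoTorsion]
  exact Nat.card_congr (Equiv.subtypeEquivRight fun b => by
    rw [MonoidHom.mem_ker, powMonoidHom_apply, pow_two])

theorem card_pUnit : Nat.card (GenDihedral PUnit) = 2 := by
  rw [Nat.card_congr equivProd, Nat.card_prod]
  simp

/-- D∞ has, for each index j, the j subgroups `dih` over jℤ and, for j even, also the rotations by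
(j/2)ℤ. The latter have quotient dihedral over ℤ/(j/2); the former have quotient of order gcd(j, 2).
-/
theorem finsum_card_hom_normalizerQuotient {A : Type*} [Group A] {P : ℕ → ℕ → ℕ}
    (hP : ∀ (B : Type) [CommGroup B] [Finite B],
      Nat.card (A →* GenDihedral B) = P (Nat.card B) (cardTwoTorsion B)) {j : ℕ} (hj : 0 < j) :
    ∑ᶠ K : {K : Subgroup (GenDihedral InfCyclic) // K.index = j},
      Nat.card (A →* NormalizerQuotient K.1) =
        if 2 ∣ j then P (j / 2) ((j / 2).gcd 2) + j * P 1 1 else j := by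
  have hone : ∀ k, numSubgroupsOfIndex InfCyclic k = 1 := card_subgroups_infCyclic
  have htor : ∀ L : Subgroup InfCyclic, L.index ≠ 0 →
      cardTwoTorsion (InfCyclic ⧸ L) = L.index.gcd 2 := by
    intro L hL
    have := Subgroup.index_ne_zero_iff_finite.1 hL
    have : IsCyclic (InfCyclic ⧸ L) :=
      isCyclic_of_surjective (QuotientGroup.mk' L) (QuotientGroup.mk'_surjective L)
    rw [cardTwoTorsion_of_isCyclic, Subgroup.index_eq_card]
  rw [finsum_subgroups (fun k _ => finite_subgroups_infCyclic k) hj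
    (fun K => Nat.card (A →* NormalizerQuotient K)) (P (j / 2) ((j / 2).gcd 2))
    (if 2 ∣ j then P 1 1 else 1), hone, hone]
  · split_ifs <;> ring
  · rintro L rfl
    have hL : L.index ≠ 0 := by omega
    have := Subgroup.index_ne_zero_iff_finite.1 hL
    obtain ⟨e⟩ := nonempty_normalizerQuotient_rot L
    rw [Nat.card_monoidHom_congr (MulEquiv.refl A) e, hP, htor L hL, ← Subgroup.index_eq_card,
      Nat.mul_div_cancel_left _ two_pos]
  · rintro L c rfl
    have hL : L.index ≠ 0 := hj.ne'
    have hcard := card_normalizerQuotient_dih L c hL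
    rw [relIndex_comap_pow_two, htor L hL] at hcard
    split_ifs with h
    · rw [Nat.gcd_eq_right h] at hcard
      have := Fact.mk Nat.prime_two
      -- A group of order 2 is the generalised dihedral group of the trivial group, so the same P
      -- applies with |B| = t = 1.
      rw [Nat.card_monoidHom_congr (MulEquiv.refl A) (mulEquivOfPrimeCardEq hcard card_pUnit), hP]
      simp [cardTwoTorsion]
    · have h1 : L.index.gcd 2 = 1 := by
        rw [Nat.gcd_comm]
        exact (Nat.prime_two.coprime_iff_not_dvd).2 h
      rw [h1, Nat.card_eq_one_iff_unique] at hcard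
      have := hcard.1
      rw [Nat.card_eq_one_iff_unique]
      exact ⟨⟨fun f g => MonoidHom.ext fun a => Subsingleton.elim _ _⟩, ⟨1⟩⟩

/-- The first summand has A ≅ ℤ², the second A ≅ p2. The constants 4 and 8 are the numbers of
homomorphisms from these groups to the group of order 2. -/
theorem numSubgroupsOfIndex_prod_eq {n : ℕ} (hn : 0 < n) :
    numSubgroupsOfIndex (GenDihedral InfCyclic × GenDihedral FreeAbTwo) n =
      ∑ p ∈ n.divisorsAntidiagonal,
        ((if 2 ∣ p.1 then σ 1 (p.1 / 2) else 0) *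
          (if 2 ∣ p.2 then ((p.2 / 2) ^ 2 + 3 * (p.2 / 2) * (p.2 / 2).gcd 2) + p.2 * 4 else p.2) +
        p.1 * σ 1 p.1 *
          (if 2 ∣ p.2 then ((p.2 / 2) ^ 3 + 6 * (p.2 / 2) * (p.2 / 2).gcd 2 ^ 2 +
            (p.2 / 2).gcd 2 ^ 3) + p.2 * 8 else p.2)) := by
  rw [numSubgroupsOfIndex_prod
    (fun k hk => finite_subgroups (fun _ => finite_subgroups_freeAbTwo) hk)
    (fun k hk => finite_subgroups (fun k _ => finite_subgroups_infCyclic k) hk)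
    (homFinite_of_index homFinite_of_index_freeAbTwo) hn]
  refine Finset.sum_congr rfl fun p hp => ?_
  obtain ⟨h1, h2⟩ := Nat.ne_zero_of_mem_divisorsAntidiagonal hp
  have h1 := Nat.pos_of_ne_zero h1
  have h2 := Nat.pos_of_ne_zero h2
  rw [finsum_subgroups (fun _ => finite_subgroups_freeAbTwo) h1
    (fun A => ∑ᶠ K : {K : Subgroup (GenDihedral InfCyclic) // K.index = p.2},
      Nat.card (A →* NormalizerQuotient K.1)), numSubgroupsOfIndex_freeAbTwo h1]
  · congr 2
    split_ifs with h
    · rw [numSubgroupsOfIndex_freeAbTwo (Nat.div_pos (Nat.le_of_dvd h1 h) two_pos)]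
    · rfl
  · intro L hL
    obtain ⟨e⟩ := L.nonempty_mulEquiv_of_free (by omega)
    exact finsum_card_hom_normalizerQuotient (P := fun q t => q ^ 2 + 3 * q * t) (fun B _ _ => by
      rw [Nat.card_monoidHom_congr ((rotEquiv L).symm.trans e) (MulEquiv.refl _),
        card_hom_freeAbTwo]) h2
  · intro L c hL
    obtain ⟨e⟩ := L.nonempty_mulEquiv_of_free (by omega)
    obtain ⟨e'⟩ := nonempty_dih_equiv L c
    exact finsum_card_hom_normalizerQuotient (P := fun q t => q ^ 3 + 6 * q * t ^ 2 + t ^ 3)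
      (fun B _ _ => by
        rw [Nat.card_monoidHom_congr (e'.symm.trans (congr e)) (MulEquiv.refl _),
          card_hom_genDihedral_freeAbTwo]) h2

end GenDihedral

/-! ### Divisor sums and Dirichlet convolution. -/

section DivisorSums

theorem sum_divisorsAntidiagonal_half_right (f : ℕ → ℕ → ℕ) {N : ℕ} (hN : 0 < N) :
    ∑ p ∈ N.divisorsAntidiagonal, (if 2 ∣ p.2 then f p.1 (p.2 / 2) else 0) =
      if 2 ∣ N then ∑ p ∈ (N / 2).divisorsAntidiagonal, f p.1 p.2 else 0 := by
  split_ifs with h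
  · obtain ⟨M, rfl⟩ := h
    rw [Nat.mul_div_cancel_left _ two_pos, ← Finset.sum_filter]
    symm
    refine Finset.sum_bij (fun p _ => (p.1, 2 * p.2)) ?_ ?_ ?_ ?_
    · rintro ⟨a, b⟩ h
      simp only [Nat.mem_divisorsAntidiagonal, Finset.mem_filter] at h ⊢
      exact ⟨⟨by rw [← h.1]; ring, hN.ne'⟩, dvd_mul_right _ _⟩
    · rintro ⟨a, b⟩ - ⟨c, d⟩ - h
      simpa using h
    · rintro ⟨a, b⟩ h
      simp only [Nat.mem_divisorsAntidiagonal, Finset.mem_filter] at h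
      obtain ⟨⟨h1, -⟩, c, rfl⟩ := h
      refine ⟨(a, c), ?_, rfl⟩
      rw [Nat.mem_divisorsAntidiagonal]
      constructor
      · dsimp only at h1 ⊢
        have : 2 * (a * c) = 2 * M := by rw [← h1]; ring
        omega
      · omega
    · rintro ⟨a, b⟩ -
      simp
  · refine Finset.sum_eq_zero fun p hp => if_neg fun h' => h ?_
    rw [← (Nat.mem_divisorsAntidiagonal.1 hp).1]
    exact h'.mul_left _

theorem sum_divisorsAntidiagonal_half_left (f : ℕ → ℕ → ℕ) {N : ℕ} (hN : 0 < N) :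
    ∑ p ∈ N.divisorsAntidiagonal, (if 2 ∣ p.1 then f (p.1 / 2) p.2 else 0) =
      if 2 ∣ N then ∑ p ∈ (N / 2).divisorsAntidiagonal, f p.1 p.2 else 0 := by
  have hswap : ∀ (M : ℕ) (g : ℕ → ℕ → ℕ), ∑ p ∈ M.divisorsAntidiagonal, g p.1 p.2 =
      ∑ p ∈ M.divisorsAntidiagonal, g p.2 p.1 := fun M g => by
    rw [← Nat.map_swap_divisorsAntidiagonal, Finset.sum_map]
    rw [Nat.map_swap_divisorsAntidiagonal]
    rfl
  rw [hswap _ fun a b => if 2 ∣ a then f (a / 2) b else 0,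
    sum_divisorsAntidiagonal_half_right (fun a b => f b a) hN, hswap _ f]

/-- Write σ = ζ * id and reassociate the convolution: id * id^(m+1) at l is Σ ab^(m+1) over ab = l,
which is l Σ b^m = lσ_m(l). -/
theorem sum_sigma_mul_pow (m N : ℕ) :
    ∑ p ∈ N.divisorsAntidiagonal, σ 1 p.1 * p.2 ^ (m + 1) =
      ∑ l ∈ N.divisors, l * σ m l := by
  have h : σ 1 * ArithmeticFunction.pow (m + 1) =
      ArithmeticFunction.zeta * (ArithmeticFunction.pow 1 * ArithmeticFunction.pow (m + 1)) := by
    rw [← mul_assoc, ArithmeticFunction.zeta_mul_pow_eq_sigma]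
  have hN := DFunLike.congr_fun h N
  rw [ArithmeticFunction.mul_apply, ArithmeticFunction.zeta_mul_apply] at hN
  have hpow : ∀ k a, ArithmeticFunction.pow (k + 1) a = a ^ (k + 1) := fun k a => by
    simp [ArithmeticFunction.pow_apply]
  simp only [hpow m] at hN
  rw [hN]
  refine Finset.sum_congr rfl fun l _ => ?_
  rw [ArithmeticFunction.mul_apply, ArithmeticFunction.sigma_apply,
    ← Nat.sum_divisorsAntidiagonal' fun _ b => b ^ m, Finset.mul_sum]
  refine Finset.sum_congr rfl fun p hp => ?_
  rw [hpow m, hpow 0, ← (Nat.mem_divisorsAntidiagonal.1 hp).1]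
  ring

theorem sum_mul_sigma_mul (N : ℕ) :
    ∑ p ∈ N.divisorsAntidiagonal, p.1 * σ 1 p.1 * p.2 = N * ∑ l ∈ N.divisors, σ 1 l := by
  rw [← Nat.sum_divisorsAntidiagonal fun a _ => σ 1 a, Finset.mul_sum]
  refine Finset.sum_congr rfl fun p hp => ?_
  rw [← (Nat.mem_divisorsAntidiagonal.1 hp).1]
  ring

/-- One factor N = p.1 p.2 comes out of each term, leaving the previous convolution with m = 1. -/
theorem sum_mul_sigma_mul_pow_three (N : ℕ) :
    ∑ p ∈ N.divisorsAntidiagonal, p.1 * σ 1 p.1 * p.2 ^ 3 = N * ∑ l ∈ N.divisors, l * σ 1 l := by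
  rw [← sum_sigma_mul_pow 1, Finset.mul_sum]
  refine Finset.sum_congr rfl fun p hp => ?_
  rw [← (Nat.mem_divisorsAntidiagonal.1 hp).1]
  ring

end DivisorSums

/-! ### Evaluation of the sum over factorisations. -/

section Count

theorem sum_mul_sigma_cubic {N : ℕ} (hN : 0 < N) :
    ∑ p ∈ N.divisorsAntidiagonal, (p.1 * σ 1 p.1 * (p.2 ^ 3 + 20 * p.2 + 1) +
      if 2 ∣ p.2 then p.1 * σ 1 p.1 * (36 * (p.2 / 2) + 7) else 0) =
    (N + 1) * ∑ l ∈ N.divisors, l * σ 1 l + 20 * N * ∑ l ∈ N.divisors, σ 1 l +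
      if 2 ∣ N then 36 * (N / 2) * ∑ l ∈ (N / 2).divisors, σ 1 l +
        7 * ∑ l ∈ (N / 2).divisors, l * σ 1 l else 0 := by
  rw [Finset.sum_add_distrib,
    sum_divisorsAntidiagonal_half_right (fun k q => k * σ 1 k * (36 * q + 7)) hN]
  have h1 : ∀ M : ℕ, ∑ p ∈ M.divisorsAntidiagonal, p.1 * σ 1 p.1 =
      ∑ l ∈ M.divisors, l * σ 1 l := fun M => Nat.sum_divisorsAntidiagonal fun a _ => a * σ 1 a
  congr 1
  · have : ∀ p ∈ N.divisorsAntidiagonal, p.1 * σ 1 p.1 * (p.2 ^ 3 + 20 * p.2 + 1) =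
        p.1 * σ 1 p.1 * p.2 ^ 3 + 20 * (p.1 * σ 1 p.1 * p.2) + p.1 * σ 1 p.1 :=
      fun p _ => by ring
    rw [Finset.sum_congr rfl this, Finset.sum_add_distrib, Finset.sum_add_distrib,
      ← Finset.mul_sum, sum_mul_sigma_mul_pow_three, sum_mul_sigma_mul, h1]
    ring
  · congr 1
    have : ∀ p ∈ (N / 2).divisorsAntidiagonal, p.1 * σ 1 p.1 * (36 * p.2 + 7) =
        36 * (p.1 * σ 1 p.1 * p.2) + 7 * (p.1 * σ 1 p.1) := fun p _ => by ring
    rw [Finset.sum_congr rfl this, Finset.sum_add_distrib, ← Finset.mul_sum, ← Finset.mul_sum,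
      sum_mul_sigma_mul, h1]
    ring

theorem sum_sigma_mul (N : ℕ) : ∑ p ∈ N.divisorsAntidiagonal, σ 1 p.1 * p.2 =
    ∑ l ∈ N.divisors, l * l.divisors.card := by
  simpa [ArithmeticFunction.sigma_zero_apply] using sum_sigma_mul_pow 0 N

theorem sum_sigma_quadratic {N : ℕ} (hN : 0 < N) :
    ∑ p ∈ N.divisorsAntidiagonal, (σ 1 p.1 * (p.2 ^ 2 + 9 * p.2) +
      if 2 ∣ p.2 then σ 1 p.1 * (6 * (p.2 / 2)) else 0) =
    ∑ l ∈ N.divisors, l * σ 1 l + 9 * ∑ l ∈ N.divisors, l * l.divisors.card +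
      if 2 ∣ N then 6 * ∑ l ∈ (N / 2).divisors, l * l.divisors.card else 0 := by
  rw [Finset.sum_add_distrib,
    sum_divisorsAntidiagonal_half_right (fun k q => σ 1 k * (6 * q)) hN]
  congr 1
  · simp only [mul_add, Finset.sum_add_distrib, mul_left_comm _ 9, ← Finset.mul_sum,
      sum_sigma_mul, sum_sigma_mul_pow 1]
  · simp only [mul_left_comm _ 6, ← Finset.mul_sum, sum_sigma_mul]

theorem numSubgroupsOfIndex_genDihedral_prod {n : ℕ} (hn : 0 < n) :
    numSubgroupsOfIndex (GenDihedral InfCyclic × GenDihedral FreeAbTwo) n =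
      n * ∑ l ∈ n.divisors, σ 1 l +
      (if 2 ∣ n then
        ((n / 2 + 1) * ∑ l ∈ (n / 2).divisors, l * σ 1 l +
          20 * (n / 2) * ∑ l ∈ (n / 2).divisors, σ 1 l +
          if 2 ∣ n / 2 then 36 * (n / 2 / 2) * ∑ l ∈ (n / 2 / 2).divisors, σ 1 l +
            7 * ∑ l ∈ (n / 2 / 2).divisors, l * σ 1 l else 0) else 0) +
      (if 2 ∣ n then
        (∑ l ∈ (n / 2).divisors, l * l.divisors.card +
          if 2 ∣ n / 2 then ∑ l ∈ (n / 2 / 2).divisors, l * σ 1 l +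
            9 * ∑ l ∈ (n / 2 / 2).divisors, l * l.divisors.card +
            (if 2 ∣ n / 2 / 2 then
              6 * ∑ l ∈ (n / 2 / 2 / 2).divisors, l * l.divisors.card else 0) else 0) else 0) := by
  rw [GenDihedral.numSubgroupsOfIndex_prod_eq hn]
  have hgcd : ∀ q : ℕ, q.gcd 2 = if 2 ∣ q then 2 else 1 := by
    intro q
    split_ifs with h
    · exact Nat.gcd_eq_right h
    · rw [Nat.gcd_comm]
      exact (Nat.prime_two.coprime_iff_not_dvd).2 h
  -- Each correction is what remains after the value for odd arguments has been removed. For j = 2q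
  -- the p2 factor is q³ + 22q + 1 if q is odd and q³ + 40q + 8 if q is even. Removing j = 2q leaves
  -- q³ + 20q + 1, with excess 18q + 7 = 36(q/2) + 7 for even q.
  let g1 : ℕ → ℕ → ℕ := fun k q => k * σ 1 k * (q ^ 3 + 20 * q + 1) +
    if 2 ∣ q then k * σ 1 k * (36 * (q / 2) + 7) else 0
  -- Likewise for ℤ²: q² + 11q or q² + 14q, less 2q, with excess 3q = 6(q/2) for even q.
  let g3 : ℕ → ℕ → ℕ := fun k q => σ 1 k * (q ^ 2 + 9 * q) +
    if 2 ∣ q then σ 1 k * (6 * (q / 2)) else 0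
  let g2 : ℕ → ℕ → ℕ := fun k j => σ 1 k * j + if 2 ∣ j then g3 k (j / 2) else 0
  have key : ∀ p ∈ n.divisorsAntidiagonal,
      ((if 2 ∣ p.1 then σ 1 (p.1 / 2) else 0) *
          (if 2 ∣ p.2 then ((p.2 / 2) ^ 2 + 3 * (p.2 / 2) * (p.2 / 2).gcd 2) + p.2 * 4 else p.2) +
        p.1 * σ 1 p.1 *
          (if 2 ∣ p.2 then ((p.2 / 2) ^ 3 + 6 * (p.2 / 2) * (p.2 / 2).gcd 2 ^ 2 +
            (p.2 / 2).gcd 2 ^ 3) + p.2 * 8 else p.2)) =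
      p.1 * σ 1 p.1 * p.2 + (if 2 ∣ p.2 then g1 p.1 (p.2 / 2) else 0) +
        (if 2 ∣ p.1 then g2 (p.1 / 2) p.2 else 0) := by
    rintro ⟨k, j⟩ -
    simp only [g1, g2, g3, hgcd]
    generalize σ 1 k = s
    generalize σ 1 (k / 2) = s'
    by_cases hj : 2 ∣ j
    · obtain ⟨q, rfl⟩ := hj
      simp only [dvd_mul_right, if_true, Nat.mul_div_cancel_left _ two_pos]
      by_cases hq : 2 ∣ q
      · obtain ⟨r, rfl⟩ := hq
        simp only [dvd_mul_right, if_true, Nat.mul_div_cancel_left _ two_pos]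
        split_ifs <;> ring
      · simp only [if_neg hq]
        split_ifs <;> ring
    · simp only [if_neg hj]
      split_ifs <;> ring
  rw [Finset.sum_congr rfl key, Finset.sum_add_distrib, Finset.sum_add_distrib,
    sum_mul_sigma_mul, sum_divisorsAntidiagonal_half_right g1 hn,
    sum_divisorsAntidiagonal_half_left g2 hn]
  by_cases h : 2 ∣ n
  · have hn2 : 0 < n / 2 := Nat.div_pos (Nat.le_of_dvd hn h) two_pos
    simp only [if_pos h]
    congr 1
    · rw [sum_mul_sigma_cubic hn2]
    · rw [Finset.sum_add_distrib, sum_sigma_mul, sum_divisorsAntidiagonal_half_right g3 hn2]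
      split_ifs with h2
      · have hn4 : 0 < n / 2 / 2 := Nat.div_pos (Nat.le_of_dvd hn2 h2) two_pos
        rw [sum_sigma_quadratic hn4, if_pos ‹_›]
      · have hn4 : 0 < n / 2 / 2 := Nat.div_pos (Nat.le_of_dvd hn2 ‹_›) two_pos
        rw [sum_sigma_quadratic hn4, if_neg ‹_›]
      · rfl
  · simp only [if_neg h]

end Count

theorem numSubgroupsOfIndex_congr {G H : Type*} [Group G] [Group H] (e : G ≃* H) (n : ℕ) :
    numSubgroupsOfIndex G n = numSubgroupsOfIndex H n := by
  rw [numSubgroupsOfIndex_eq_card, numSubgroupsOfIndex_eq_card]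
  exact Nat.card_congr (e.mapSubgroup.toEquiv.subtypeEquiv fun L => by
    change _ ↔ (L.map e.toMonoidHom).index = n
    rw [← Subgroup.index_map_equiv L e]
    rfl)

/-! ### The splitting of P2/m as D∞ × p2. -/

namespace P2m

open Gen

/-- The images of the generators in `D∞ × (ℤ² ⋊ ±1)`. -/
def toProdFun : Gen → GenDihedral InfCyclic × GenDihedral FreeAbTwo
  | .x => (1, ⟨(Multiplicative.ofAdd 1, 1), 1⟩)
  | .y => (⟨Multiplicative.ofAdd 1, 1⟩, 1)
  | .z => (1, ⟨(1, Multiplicative.ofAdd 1), 1⟩)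
  | .r => (1, .refl)
  | .m => (.refl, 1)

theorem toProdFun_rels : ∀ w ∈ rels, FreeGroup.lift toProdFun w = 1 := by
  intro w hw
  simp only [rels, Set.mem_insert_iff, Set.mem_singleton_iff] at hw
  rcases hw with rfl | rfl | rfl | rfl | rfl | rfl | rfl | rfl | rfl | rfl | rfl | rfl <;>
  simp [conjBy, commutatorElement_def, toProdFun, GenDihedral.refl, pow_two, g, Prod.ext_iff]

/-- The homomorphism from the presented group to the product. -/
def toProd : Grp →* GenDihedral InfCyclic × GenDihedral FreeAbTwo :=
  PresentedGroup.toGroup toProdFun_rels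

/-- The generators of the presented group. -/
abbrev gen (a : Gen) : Grp := PresentedGroup.of a

theorem rel_eq_one {w : FreeGroup Gen} (hw : w ∈ rels) : PresentedGroup.mk rels w = 1 :=
  PresentedGroup.one_of_mem hw

theorem commute_x_y : Commute (gen x) (gen y) :=
  commutatorElement_eq_one_iff_commute.1 (rel_eq_one (by simp [rels] : ⁅g x, g y⁆ ∈ rels))

theorem commute_x_z : Commute (gen x) (gen z) :=
  commutatorElement_eq_one_iff_commute.1 (rel_eq_one (by simp [rels] : ⁅g x, g z⁆ ∈ rels))

theorem commute_y_z : Commute (gen y) (gen z) :=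
  commutatorElement_eq_one_iff_commute.1 (rel_eq_one (by simp [rels] : ⁅g y, g z⁆ ∈ rels))

theorem r_mul_r : gen r * gen r = 1 := by
  have := rel_eq_one (by simp [rels] : g r ^ 2 ∈ rels)
  rwa [map_pow, pow_two] at this

theorem m_mul_m : gen m * gen m = 1 := by
  have := rel_eq_one (by simp [rels] : g m ^ 2 ∈ rels)
  rwa [map_pow, pow_two] at this

theorem inv_r : (gen r)⁻¹ = gen r := inv_eq_of_mul_eq_one_left r_mul_r

theorem inv_m : (gen m)⁻¹ = gen m := inv_eq_of_mul_eq_one_left m_mul_m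

theorem commute_m_r : Commute (gen m) (gen r) := by
  have h : gen m * gen r * (gen m * gen r) = 1 := by
    have := rel_eq_one (by simp [rels] : (g m * g r) ^ 2 ∈ rels)
    rwa [map_pow, pow_two, map_mul] at this
  have := inv_eq_of_mul_eq_one_left h
  rw [mul_inv_rev, inv_r, inv_m] at this
  exact this.symm

theorem conj_eq {a b c : Gen} {ε : FreeGroup Gen} (h : conjBy (g a) (g b) * ε⁻¹ ∈ rels)
    (hc : PresentedGroup.mk rels (g b) = gen c) (hi : (gen c)⁻¹ = gen c) :
    gen c * gen a * gen c = PresentedGroup.mk rels ε := by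
  have := rel_eq_one h
  rw [map_mul, map_inv, mul_inv_eq_one, conjBy, map_mul, map_mul, map_inv, hc, hi] at this
  exact this

theorem commute_x_m : Commute (gen m) (gen x) := by
  have h : gen m * gen x * gen m = gen x :=
    conj_eq (by simp [rels] : conjBy (g x) (g m) * (g x)⁻¹ ∈ rels) rfl inv_m
  calc gen m * gen x = gen m * gen x * (gen m * gen m) := by rw [m_mul_m, mul_one]
    _ = gen x * gen m := by rw [← mul_assoc, h]

theorem commute_z_m : Commute (gen m) (gen z) := by
  have h : gen m * gen z * gen m = gen z :=
    conj_eq (by simp [rels] : conjBy (g z) (g m) * (g z)⁻¹ ∈ rels) rfl inv_m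
  calc gen m * gen z = gen m * gen z * (gen m * gen m) := by rw [m_mul_m, mul_one]
    _ = gen z * gen m := by rw [← mul_assoc, h]

theorem commute_y_r : Commute (gen r) (gen y) := by
  have h : gen r * gen y * gen r = gen y :=
    conj_eq (by simp [rels] : conjBy (g y) (g r) * (g y)⁻¹ ∈ rels) rfl inv_r
  calc gen r * gen y = gen r * gen y * (gen r * gen r) := by rw [r_mul_r, mul_one]
    _ = gen y * gen r := by rw [← mul_assoc, h]

theorem conj_y_m : gen m * gen y * gen m = (gen y)⁻¹ :=
  conj_eq (by simp [rels] : conjBy (g y) (g m) * ((g y)⁻¹)⁻¹ ∈ rels) rfl inv_m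

theorem conj_x_r : gen r * gen x * gen r = (gen x)⁻¹ :=
  conj_eq (by simp [rels] : conjBy (g x) (g r) * ((g x)⁻¹)⁻¹ ∈ rels) rfl inv_r

theorem conj_z_r : gen r * gen z * gen r = (gen z)⁻¹ :=
  conj_eq (by simp [rels] : conjBy (g z) (g r) * ((g z)⁻¹)⁻¹ ∈ rels) rfl inv_r

/-- The inclusion of the infinite dihedral factor generated by `y` and `m`. -/
def ofDihedral : GenDihedral InfCyclic →* Grp :=
  GenDihedral.lift (zpowersHom Grp (gen y)) (gen m) m_mul_m fun a => by
    have hconj : ∀ w, gen m * w * gen m = MulAut.conj (gen m) w := fun w => by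
      rw [MulAut.conj_apply, inv_m]
    rw [zpowersHom_apply, hconj, map_zpow, ← hconj, conj_y_m, inv_zpow]

/-- The inclusion of the plane group factor generated by `x`, `z` and `r`. -/
def ofPlane : GenDihedral FreeAbTwo →* Grp :=
  GenDihedral.lift (freeAbTwoLift (gen x) (gen z) commute_x_z) (gen r) r_mul_r fun a => by
    have hconj : ∀ w, gen r * w * gen r = MulAut.conj (gen r) w := fun w => by
      rw [MulAut.conj_apply, inv_r]
    obtain ⟨a, b⟩ := a
    have e := freeAbTwoLift_apply (gen x) (gen z) commute_x_z a b
    rw [e, hconj, map_mul, map_zpow, map_zpow, ← hconj, ← hconj, conj_x_r, conj_z_r, inv_zpow,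
      inv_zpow, ← mul_inv_rev, inv_inj]
    exact (commute_x_z.zpow_zpow _ _).symm

/-- It suffices that `y` and `m` commute with each of `x`, `z`, `r`, which the relators provide. -/
theorem commute_ofDihedral_ofPlane (p : GenDihedral InfCyclic) (q : GenDihedral FreeAbTwo) :
    Commute (ofDihedral p) (ofPlane q) := by
  have aux : ∀ w : Grp, Commute (gen y) w → Commute (gen m) w → Commute (ofDihedral p) w := by
    intro w hy hm
    change Commute (_ * if p.sgn = 1 then _ else _) w
    refine Commute.mul_left (hy.zpow_left _) ?_
    split_ifs
    exacts [Commute.one_left _, hm]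
  have h1 : Commute (ofDihedral p) (gen x) := aux _ commute_x_y.symm commute_x_m
  have h2 : Commute (ofDihedral p) (gen z) := aux _ commute_y_z commute_z_m
  have h3 : Commute (ofDihedral p) (gen r) := aux _ commute_y_r.symm commute_m_r
  change Commute _ ((_ : Grp) * if q.sgn = 1 then 1 else gen r)
  refine Commute.mul_right ?_ ?_
  · obtain ⟨⟨a, b⟩, s⟩ := q
    have e := freeAbTwoLift_apply (gen x) (gen z) commute_x_z a b
    rw [e]
    exact (h1.zpow_right _).mul_right (h2.zpow_right _)
  · split_ifs
    exacts [Commute.one_right _, h3]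

/-- The homomorphism from the product to the presented group. -/
def ofProd : GenDihedral InfCyclic × GenDihedral FreeAbTwo →* Grp :=
  MonoidHom.noncommCoprod ofDihedral ofPlane commute_ofDihedral_ofPlane

theorem ofProd_toProdFun (a : Gen) : ofProd (toProdFun a) = gen a := by
  rw [ofProd, MonoidHom.noncommCoprod_apply]
  cases a <;> simp [toProdFun, ofDihedral, ofPlane]
  exacts [freeAbTwoLift_fst _ _ _, freeAbTwoLift_snd _ _ _]

theorem toProd_gen (a : Gen) : toProd (gen a) = toProdFun a := PresentedGroup.toGroup.of _

/-- `P2/m` is the product of the infinite dihedral group and the plane group `p2`. -/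
def equivProd : Grp ≃* GenDihedral InfCyclic × GenDihedral FreeAbTwo :=
  MonoidHom.toMulEquiv toProd ofProd
    (PresentedGroup.ext fun a => by
      change ofProd (toProd (gen a)) = gen a
      rw [toProd_gen, ofProd_toProdFun])
    (by
      -- The images of the five generators determine a homomorphism on each factor, so checking the
      -- composite on them is enough.
      have h : ∀ a, toProd (ofProd (toProdFun a)) = toProdFun a := fun a => by
        rw [ofProd_toProdFun, toProd_gen]
      have hl : (toProd.comp ofProd).comp (MonoidHom.inl _ _) = MonoidHom.inl _ _ :=
        GenDihedral.hom_ext (MonoidHom.ext_mint (h y)) (h m)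
      have hr : (toProd.comp ofProd).comp (MonoidHom.inr _ _) = MonoidHom.inr _ _ :=
        GenDihedral.hom_ext (freeAbTwo_hom_ext (h x) (h z)) (h r)
      ext1 ⟨p, q⟩
      have : ((p, q) : GenDihedral InfCyclic × GenDihedral FreeAbTwo) = (p, 1) * (1, q) := by simp
      rw [this, map_mul, map_mul]
      exact congrArg₂ (· * ·) (DFunLike.congr_fun hl p) (DFunLike.congr_fun hr q))

end P2m

/-! ### Case distinction modulo 8. -/

theorem proposition4p1 :
    (∀ n : ℕ, 0 < n →
      ((n % 8 = 2 ∨ n % 8 = 6) →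
        numSubgroupsOfIndex P2m.Grp n =
          n * (∑ l ∈ n.divisors, σ 1 l)
          + 10 * n * (∑ l ∈ (n / 2).divisors, σ 1 l)
          + (∑ l ∈ (n / 2).divisors, l * l.divisors.card)
          + (n / 2 + 1) * (∑ l ∈ (n / 2).divisors, l * σ 1 l)) ∧
      (n % 8 = 4 →
        numSubgroupsOfIndex P2m.Grp n =
          n * (∑ l ∈ n.divisors, σ 1 l)
          + 10 * n * (∑ l ∈ (n / 2).divisors, σ 1 l)
          + 9 * n * (∑ l ∈ (n / 4).divisors, σ 1 l)
          + (∑ l ∈ (n / 2).divisors, l * l.divisors.card)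
          + 9 * (∑ l ∈ (n / 4).divisors, l * l.divisors.card)
          + 8 * (∑ l ∈ (n / 4).divisors, l * σ 1 l)
          + (n / 2 + 1) * (∑ l ∈ (n / 2).divisors, l * σ 1 l)) ∧
      (n % 8 = 0 →
        numSubgroupsOfIndex P2m.Grp n =
          n * (∑ l ∈ n.divisors, σ 1 l)
          + 10 * n * (∑ l ∈ (n / 2).divisors, σ 1 l)
          + 9 * n * (∑ l ∈ (n / 4).divisors, σ 1 l)
          + (∑ l ∈ (n / 2).divisors, l * l.divisors.card)
          + 9 * (∑ l ∈ (n / 4).divisors, l * l.divisors.card)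
          + 8 * (∑ l ∈ (n / 4).divisors, l * σ 1 l)
          + (n / 2 + 1) * (∑ l ∈ (n / 2).divisors, l * σ 1 l)
          + 6 * (∑ l ∈ (n / 8).divisors, l * l.divisors.card)) ∧
      (Odd n →
        numSubgroupsOfIndex P2m.Grp n = n * (∑ l ∈ n.divisors, σ 1 l))) ∧
    (∀ p : ℕ, p.Prime → Odd p →
      numSubgroupsOfIndex P2m.Grp p = p ^ 2 + 2 * p) := by
  have key := fun (n : ℕ) (hn : 0 < n) =>
    (numSubgroupsOfIndex_congr P2m.equivProd n).trans (numSubgroupsOfIndex_genDihedral_prod hn)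
  have odd : ∀ n : ℕ, 0 < n → Odd n →
      numSubgroupsOfIndex P2m.Grp n = n * (∑ l ∈ n.divisors, σ 1 l) := by
    intro n hn h
    have h2 : ¬ 2 ∣ n := h.not_two_dvd_nat
    rw [key n hn, if_neg h2, if_neg h2, add_zero, add_zero]
  refine ⟨fun n hn => ⟨fun h => ?_, fun h => ?_, fun h => ?_, odd n hn⟩, fun p hp h => ?_⟩
  · obtain ⟨N, rfl⟩ : 2 ∣ n := by omega
    have h2 : ¬ 2 ∣ N := by omega
    rw [key _ hn]
    simp only [dvd_mul_right, if_true, Nat.mul_div_cancel_left _ two_pos, if_neg h2]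
    ring
  · obtain ⟨N, rfl⟩ : 4 ∣ n := by omega
    have h2 : ¬ 2 ∣ N := by omega
    have e1 : 4 * N / 2 = 2 * N := by omega
    have e2 : 4 * N / 4 = N := by omega
    have e3 : 2 ∣ 4 * N := by omega
    rw [key _ hn]
    -- The coefficient 8 of Σ lσ(l) over l ∣ n/4 collects 7 from the case A ≅ p2 and 1 from A ≅ ℤ²;
    -- 9n is 36(n/4).
    simp only [e1, e2, e3, dvd_mul_right, if_true, Nat.mul_div_cancel_left _ two_pos, if_neg h2]
    ring
  · obtain ⟨N, rfl⟩ : 8 ∣ n := by omega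
    have e1 : 8 * N / 2 = 4 * N := by omega
    have e2 : 8 * N / 4 = 2 * N := by omega
    have e3 : 4 * N / 2 = 2 * N := by omega
    have e4 : 8 * N / 8 = N := by omega
    have e5 : 2 ∣ 8 * N := by omega
    have e6 : 2 ∣ 4 * N := by omega
    rw [key _ hn]
    simp only [e1, e2, e3, e4, e5, e6, dvd_mul_right, if_true, Nat.mul_div_cancel_left _ two_pos]
    ring
  -- For a prime the divisor sum is σ(1) + σ(p) = p + 2.
  · rw [odd p hp.pos h, hp.sum_divisors, ArithmeticFunction.sigma_one_apply, hp.sum_divisors,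
      ArithmeticFunction.sigma_one]
    ring
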